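/- Let $\mathbb T=\mathbb R/2\pi\mathbb Z$, let $p\ge 3$ be an odd integer, and let $a:\mathbb T\to[0,\infty)$ be a $C^\infty$ function for which there are a constant $a_0>0$ and a nonempty open set $\mathcal I_1\subset\mathbb T$ with $a(x)\ge a_0$ for all $x\in\mathcal I_1$. For $u\in H^1(\mathbb T;\mathbb C)$ put $$E(u)=\frac12\int_{\mathbb T}|u|^2\,dx+\frac12\int_{\mathbb T}|u_x|^2\,dx+\frac1{p+1}\int_{\mathbb T}|u|^{p+1}\,dx .$$ Then there exist constants $C,\beta>0$ (depending only on $p$ and $a$) such that for every $u_0\in H^1(\mathbb T;\mathbb C)$ the unforced locally damped nonlinear Schrödinger equation $$iu_t+u_{xx}+ia(x)u=|u|^{p-1}u,\qquad u(0,\cdot)=u_0,$$ has a unique global strong solution $u\in C([0,\infty);H^1(\mathbb T))$ (that is, a solution of the Duhamel formula), and this solution satisfies $$E(u(t))\le C\,E(u_0)\,e^{-\beta t}\qquad\text{for all }t\ge 0 .$$ -/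

import Mathlib

open MeasureTheory Filter Topology
open scoped Real ENNReal ContDiff

namespace NLS

noncomputable section

instance factTwoPiPos : Fact (0 < 2 * π) := ⟨Real.two_pi_pos⟩

/-- The circle `ℝ / 2πℤ`. Its `volume` has total mass `2π`. -/
abbrev Torus : Type := AddCircle (2 * π)

/-- The space `L²(𝕋; ℂ)`. Mathlib's Fourier basis lives on the `L²` space of the normalized Haar
measure, which is `volume / (2π)`, so that this has the same elements as `L²` of `volume`. -/
abbrev L2 : Type := Lp ℂ 2 (AddCircle.haarAddCircle : Measure Torus)

/-- The Sobolev space `H¹(𝕋)`: those `u ∈ L²` for which `∑ (1 + k²) |û(k)|²` is finite. As a subtype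
of `L2` it also inherits the `L²` norm, which is never used: the `H¹` norm is `h1Norm`. -/
def H1 : Submodule ℂ L2 where
  carrier := {f | Summable fun k : ℤ => (1 + (k : ℝ) ^ 2) * ‖fourierCoeff f k‖ ^ 2}
  zero_mem' := by
    simp only [Set.mem_ofPred_eq, ← fourierBasis_repr]
    simp
  add_mem' := by
    intro f g hf hg
    simp only [Set.mem_ofPred_eq, ← fourierBasis_repr] at hf hg ⊢
    refine Summable.of_nonneg_of_le (fun k => by positivity) (fun k => ?_)
      ((hf.mul_left 2).add (hg.mul_left 2))
    rw [map_add, lp.coeFn_add, Pi.add_apply]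
    have h1 := norm_add_le (fourierBasis.repr f k) (fourierBasis.repr g k)
    have h2 : ‖fourierBasis.repr f k + fourierBasis.repr g k‖ ^ 2
        ≤ 2 * ‖fourierBasis.repr f k‖ ^ 2 + 2 * ‖fourierBasis.repr g k‖ ^ 2 := by
      have h3 := pow_le_pow_left₀ (norm_nonneg _) h1 2
      nlinarith [sq_nonneg (‖fourierBasis.repr f k‖ - ‖fourierBasis.repr g k‖)]
    have h4 : (0 : ℝ) ≤ 1 + (k : ℝ) ^ 2 := by positivity
    have h5 := mul_le_mul_of_nonneg_left h2 h4
    linarith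
  smul_mem' := by
    intro c f hf
    simp only [Set.mem_ofPred_eq, ← fourierBasis_repr] at hf ⊢
    refine (hf.mul_left (‖c‖ ^ 2)).congr fun k => ?_
    rw [map_smul, lp.coeFn_smul, Pi.smul_apply, norm_smul]
    ring

/-- The `H¹` norm, `‖u‖² = ∑ (1 + k²) |û(k)|²` with `û(k) = (2π)^(-1/2) ∫ u(x) e^{-ikx} dx`, which
is `(2π)^(1/2)` times the normalized coefficient `fourierCoeff u k`. -/
def h1Norm (u : H1) : ℝ :=
  Real.sqrt (2 * π * ∑' k : ℤ, (1 + (k : ℝ) ^ 2) * ‖fourierCoeff (u : L2) k‖ ^ 2)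

theorem h1_summable (u : H1) :
    Summable fun k : ℤ => (1 + (k : ℝ) ^ 2) * ‖fourierCoeff (u : L2) k‖ ^ 2 := u.2

theorem memlp_weakDeriv (u : H1) :
    Memℓp (fun k : ℤ => Complex.I * (k : ℂ) * fourierCoeff (u : L2) k) 2 := by
  refine (memℓp_gen_iff (by norm_num)).2 ?_
  refine Summable.of_nonneg_of_le (fun k => by positivity) (fun k => ?_) (h1_summable u)
  simp only [ENNReal.toReal_ofNat, Real.rpow_two, norm_mul, Complex.norm_I, one_mul,
    Complex.norm_intCast, mul_pow, sq_abs]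
  nlinarith [sq_nonneg ‖fourierCoeff (u : L2) k‖]

/-- The derivative `u_x ∈ L²` of `u ∈ H¹`, with Fourier coefficients `i k û(k)`. -/
def weakDeriv (u : H1) : L2 :=
  fourierBasis.repr.symm ⟨_, memlp_weakDeriv u⟩

theorem memlp_freeGroup (t : ℝ) (f : L2) :
    Memℓp (fun k : ℤ => Complex.exp (-Complex.I * (k : ℂ) ^ 2 * (t : ℂ)) * fourierCoeff f k) 2 := by
  refine (memℓp_gen_iff (by norm_num)).2 ?_
  refine ((memℓp_gen_iff (by norm_num)).1 (lp.memℓp (fourierBasis.repr f))).congr fun k => ?_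
  have h : -Complex.I * (k : ℂ) ^ 2 * (t : ℂ) = ((-(k : ℝ) ^ 2 * t : ℝ) : ℂ) * Complex.I := by
    push_cast; ring
  rw [h, norm_mul, Complex.norm_exp_ofReal_mul_I, one_mul, fourierBasis_repr]

/-- The free Schrödinger group `S(t) = exp (i t ∂ₓ²)` on `L²`: the Fourier coefficients are
multiplied by `e^{-ik²t}`. -/
def freeGroup (t : ℝ) (f : L2) : L2 :=
  fourierBasis.repr.symm ⟨_, memlp_freeGroup t f⟩

/-- Elements of `H¹` agree almost everywhere with a continuous function. -/
theorem h1_exists_continuous (u : H1) :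
    ∃ g : C(Torus, ℂ), ((u : L2) : Torus → ℂ) =ᵐ[AddCircle.haarAddCircle] g := by
  have hs : Summable (fun k : ℤ => fourierCoeff (u : L2) k) := by
    have h1 : Summable fun k : ℤ => 1 / (k : ℝ) ^ 2 :=
      Real.summable_one_div_int_pow.2 (by norm_num)
    have h2 : Summable fun k : ℤ => ((1 : ℝ) / (k : ℝ) ^ 2) +
        (1 + (k : ℝ) ^ 2) * ‖fourierCoeff (u : L2) k‖ ^ 2 := h1.add (h1_summable u)
    refine Summable.of_norm_bounded_eventually h2 ?_
    have h0 : ∀ᶠ k : ℤ in cofinite, k ≠ 0 := (Set.finite_singleton (0 : ℤ)).compl_mem_cofinite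
    filter_upwards [h0] with k hk
    have hk' : (0 : ℝ) < (k : ℝ) ^ 2 := by positivity
    set c := ‖fourierCoeff (u : L2) k‖ with hc
    have e : (1 : ℝ) / (k : ℝ) ^ 2 * ((k : ℝ) ^ 2) = 1 := by field_simp
    have hp : (0 : ℝ) < 1 / (k : ℝ) ^ 2 := by positivity
    set y := (1 : ℝ) / (k : ℝ) ^ 2
    have h3 : 0 ≤ y * ((k : ℝ) ^ 2 * c - 1) ^ 2 := by positivity
    have h4 : y * ((k : ℝ) ^ 2 * c - 1) ^ 2 = (k : ℝ) ^ 2 * c ^ 2 - 2 * c + y := by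
      have : y * ((k : ℝ) ^ 2 * c - 1) ^ 2
          = (y * (k : ℝ) ^ 2) * ((k : ℝ) ^ 2 * c ^ 2) - 2 * (y * (k : ℝ) ^ 2) * c + y := by ring
      rw [this, e]; ring
    have hc0 : 0 ≤ c := norm_nonneg _
    nlinarith [sq_nonneg c]
  have hsum : Summable (fun k : ℤ => fourierCoeff (u : L2) k • (fourier k : C(Torus, ℂ))) := by
    refine Summable.of_norm ?_
    simpa [norm_smul, fourier_norm] using hs.norm
  obtain ⟨g, hg⟩ := hsum
  refine ⟨g, ?_⟩
  have h1 := (ContinuousMap.toLp (E := ℂ) 2 (AddCircle.haarAddCircle : Measure Torus) ℂ).hasSum hg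
  have h2 := hasSum_fourier_series_L2 (u : L2)
  have h3 : (u : L2) = ContinuousMap.toLp (E := ℂ) 2 AddCircle.haarAddCircle ℂ g := by
    refine h2.unique ?_
    convert h1 using 1
    funext k
    simp [fourierLp]
  rw [h3]
  exact ContinuousMap.coeFn_toLp _ _

theorem memLp_drift (a : C(Torus, ℝ)) (p : ℕ) (u : H1) :
    MemLp (fun x : Torus => -(a x : ℂ) * (u : L2) x
      - Complex.I * ((‖(u : L2) x‖ : ℂ) ^ (p - 1) * (u : L2) x)) 2 AddCircle.haarAddCircle := by
  obtain ⟨g, hg⟩ := h1_exists_continuous u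
  let G : C(Torus, ℂ) := ⟨fun x => -(a x : ℂ) * g x
      - Complex.I * ((‖g x‖ : ℂ) ^ (p - 1) * g x), by fun_prop⟩
  refine (Lp.memLp (ContinuousMap.toLp (E := ℂ) 2 AddCircle.haarAddCircle ℂ G)).ae_eq ?_
  filter_upwards [hg, ContinuousMap.coeFn_toLp (E := ℂ) (p := 2) (𝕜 := ℂ)
    AddCircle.haarAddCircle G] with x h1 h2
  rw [h2, h1]
  rfl

/-- The lower-order part `-a u - i |u|^(p-1) u` of the equation
`u_t = i u_xx - a u - i |u|^(p-1) u`. -/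
def drift (a : C(Torus, ℝ)) (p : ℕ) (u : H1) : L2 :=
  (memLp_drift a p u).toLp _

/-- `u : [0, ∞) → H¹` is a global strong solution of
`i u_t + u_xx + i a u = |u|^(p-1) u`, `u(0) = u₀`: it lies in `C([0, ∞); H¹)` and satisfies
the Duhamel formula. The values of `u` at negative times play no role. -/
structure IsStrongSolution (a : C(Torus, ℝ)) (p : ℕ) (u₀ : H1) (u : ℝ → H1) : Prop where
  continuous : ∀ t₀ : ℝ, 0 ≤ t₀ →
    Tendsto (fun t => h1Norm (u t - u t₀)) (𝓝[Set.Ici 0] t₀) (𝓝 0)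
  duhamel : ∀ t : ℝ, 0 ≤ t →
    (u t : L2) = freeGroup t u₀ + ∫ τ in (0 : ℝ)..t, freeGroup (t - τ) (drift a p (u τ))

/-- The `H¹` energy `½ ∫ |u|² + ½ ∫ |u_x|² + (p+1)⁻¹ ∫ |u|^(p+1)` (integrals over the circle of
length `2π`). -/
def energy (p : ℕ) (u : H1) : ℝ :=
  1 / 2 * (∫ x : Torus, ‖(u : L2) x‖ ^ 2) + 1 / 2 * (∫ x : Torus, ‖weakDeriv u x‖ ^ 2)
    + 1 / ((p : ℝ) + 1) * ∫ x : Torus, ‖(u : L2) x‖ ^ (p + 1)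

/-- A smooth non-negative damping coefficient on the circle, bounded below by a positive constant
on some nonempty open set (it may vanish elsewhere). -/
structure IsLocalizedDamping (a : C(Torus, ℝ)) : Prop where
  smooth : ContDiff ℝ ∞ (fun x : ℝ => a (x : Torus))
  nonneg : ∀ x, 0 ≤ a x
  localized : ∃ a₀ : ℝ, 0 < a₀ ∧ ∃ I : Set Torus, IsOpen I ∧ I.Nonempty ∧ ∀ x ∈ I, a₀ ≤ a x

end

end NLS

/-!
Conjugating by the free group turns the equation into an ordinary differential equation in `H¹`
whose right-hand side is Lipschitz on balls, because `H¹` is an algebra and `p` is odd, so that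
`|u|^(p-1) u` is a polynomial in `u` and its conjugate. Picard-Lindelöf gives local solutions and
uniqueness, and an a priori bound in `H¹` makes the solutions global. This bound and the exponential
decay both follow from one Lyapunov functional, whose constants do not depend on the solution.

Write `M = ∫ |u|²`, `A = ∫ |u_x|²`, `B = ∫ |u|^(p+1)`, let `Mₐ`, `Aₐ`, `Bₐ` be the same integrals
with the weight `a`, and put `Q = Re ∫ a' u ū_x`. Solutions satisfy
* `M' = -2 Mₐ`,
* `(A / 2 + B / (p + 1))' = -Aₐ - Bₐ - Q`.

Since `a` is smooth and non-negative, `|a'|² ≤ D a` (`exists_sq_deriv_le`), so that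
`|Q| ≤ η A + (D / 4η) Mₐ` for every `η > 0`. What is missing is a term `-A - B`. It comes from the
virial functional `P = Im ∫ φ ū u_x`, for which `P' = 2 ∫ φ' |u_x|² + (p-1)/(p+1) ∫ φ' |u|^(p+1)`
up to lower-order terms (`isDerivAlong_virial`, `VirialData.virial_balance`). The multiplier is
chosen with `φ' = 1 - c a`, where `1 / c` is the mean value of `a`: then `φ` is periodic, the
negative part of `φ'` is dominated by `a`, and `φ'' = -c a'` only produces another multiple of `Q`.
The functional `K M + A / 2 + B / (p + 1) - δ P`, with `δ` small and then `K` large, has derivative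
at most `-c₀ (Mₐ + A + B)` (`dissipation_le`), which by the Poincaré inequality
`M ≤ C (A + Mₐ)` is at most `-β` times the functional (`VirialData.exists_lyapunov`).

An `H¹` solution is not regular enough for these computations. The balance laws are therefore proved
for the frequency truncations of the solution of `u_t = i u_xx + f`, where `f` is continuous with
values in `H¹`, and passed to the limit in integrated form (`IsDerivAlong.hasDerivAt_mild`).

All integrals are taken with respect to the normalized Haar measure, which changes the energy by the
factor `2π` only.
-/

namespace NLS

noncomputable section

open scoped ComplexConjugate InnerProductSpace

/-! ### Fourier coefficients and Fourier multipliers on `L²` -/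

/-- The normalized Haar measure of the circle. -/
abbrev haar : Measure Torus := AddCircle.haarAddCircle

/-- The `k`-th Fourier coefficient as a continuous linear functional on `L²`. -/
def coeffL (k : ℤ) : L2 →L[ℂ] ℂ := innerSL ℂ (fourierBasis k : L2)

theorem coeffL_apply (k : ℤ) (f : L2) : coeffL k f = fourierCoeff f k := by
  rw [← fourierBasis_repr, HilbertBasis.repr_apply_apply]; rfl

theorem coeffL_eq_repr (k : ℤ) (f : L2) : coeffL k f = fourierBasis.repr f k := by
  rw [HilbertBasis.repr_apply_apply]; rfl

theorem ext_coeffL {f g : L2} (h : ∀ k, coeffL k f = coeffL k g) : f = g := by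
  apply fourierBasis.repr.injective
  ext k
  rw [← coeffL_eq_repr, ← coeffL_eq_repr, h]

theorem coeffL_repr_symm (c : lp (fun _ : ℤ => ℂ) 2) (k : ℤ) :
    coeffL k (fourierBasis.repr.symm c : L2) = c k := by
  rw [coeffL_eq_repr, LinearIsometryEquiv.apply_symm_apply]

theorem hasSum_norm_sq_coeffL (f : L2) : HasSum (fun k => ‖coeffL k f‖ ^ 2) (‖f‖ ^ 2) := by
  have h := lp.hasSum_norm (p := 2) (by norm_num) (fourierBasis.repr f)
  simp only [ENNReal.toReal_ofNat, Real.rpow_two, LinearIsometryEquiv.norm_map] at h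
  simpa only [coeffL_eq_repr] using h

theorem hasSum_inner_coeffL (f g : L2) :
    HasSum (fun k => conj (coeffL k f) * coeffL k g) ⟪f, g⟫_ℂ := by
  have h := lp.hasSum_inner (𝕜 := ℂ) (fourierBasis.repr f) (fourierBasis.repr g)
  rw [LinearIsometryEquiv.inner_map_map] at h
  simpa only [coeffL_eq_repr, RCLike.inner_apply, mul_comm] using h

theorem hasSum_fourierBasis (f : L2) :
    HasSum (fun k => coeffL k f • (fourierBasis k : L2)) f := by
  simpa only [coeffL_eq_repr] using fourierBasis.hasSum_repr f

theorem coeffL_fourierBasis (k l : ℤ) :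
    coeffL k (fourierBasis l : L2) = if k = l then 1 else 0 := by
  have := orthonormal_iff_ite.1 (fourierBasis (T := 2 * π)).orthonormal k l
  simpa [coeffL] using this

theorem memlp_multiplier {m : ℤ → ℂ} (hm : ∀ k, ‖m k‖ ≤ 1) (f : L2) :
    Memℓp (fun k => m k * coeffL k f) 2 := by
  refine (memℓp_gen_iff (by norm_num)).2 ?_
  refine Summable.of_nonneg_of_le (fun k => by positivity) (fun k => ?_)
    (hasSum_norm_sq_coeffL f).summable
  simp only [ENNReal.toReal_ofNat, Real.rpow_two, norm_mul]
  gcongr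
  exact mul_le_of_le_one_left (norm_nonneg _) (hm k)

/-- The Fourier multiplier with symbol `m`, where `|m| ≤ 1`. -/
def multiplier (m : ℤ → ℂ) (hm : ∀ k, ‖m k‖ ≤ 1) : L2 →L[ℂ] L2 :=
  LinearMap.mkContinuous
    { toFun := fun f => fourierBasis.repr.symm ⟨_, memlp_multiplier hm f⟩
      map_add' := fun f g => ext_coeffL fun k => by
        rw [map_add, coeffL_repr_symm, coeffL_repr_symm, coeffL_repr_symm]
        change m k * coeffL k (f + g) = m k * coeffL k f + m k * coeffL k g
        rw [map_add, mul_add]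
      map_smul' := fun c f => ext_coeffL fun k => by
        simp only [map_smul, coeffL_repr_symm, smul_eq_mul, RingHom.id_apply]
        ring } 1 fun f => by
    rw [one_mul]
    refine (sq_le_sq₀ (norm_nonneg _) (norm_nonneg _)).1 ?_
    refine hasSum_le (fun k => ?_) (hasSum_norm_sq_coeffL _) (hasSum_norm_sq_coeffL f)
    rw [LinearMap.coe_mk, AddHom.coe_mk, coeffL_repr_symm, norm_mul]
    gcongr
    exact mul_le_of_le_one_left (norm_nonneg _) (hm k)

@[simp] theorem coeffL_multiplier (m : ℤ → ℂ) (hm : ∀ k, ‖m k‖ ≤ 1) (f : L2) (k : ℤ) :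
    coeffL k (multiplier m hm f) = m k * coeffL k f :=
  coeffL_repr_symm _ k

theorem norm_multiplier_le (m : ℤ → ℂ) (hm : ∀ k, ‖m k‖ ≤ 1) (f : L2) :
    ‖multiplier m hm f‖ ≤ ‖f‖ := by
  refine (sq_le_sq₀ (norm_nonneg _) (norm_nonneg _)).1 ?_
  refine hasSum_le (fun k => ?_) (hasSum_norm_sq_coeffL _) (hasSum_norm_sq_coeffL f)
  rw [coeffL_multiplier, norm_mul]
  gcongr
  exact mul_le_of_le_one_left (norm_nonneg _) (hm k)

/-- Multipliers with pointwise convergent symbols converge strongly. -/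
theorem tendsto_multiplier {α : Type*} {l : Filter α} [l.IsCountablyGenerated]
    {m : α → ℤ → ℂ} {m₀ : ℤ → ℂ} (hm : ∀ n k, ‖m n k‖ ≤ 1) (hm₀ : ∀ k, ‖m₀ k‖ ≤ 1)
    (h : ∀ k, Tendsto (fun n => m n k) l (𝓝 (m₀ k))) (f : L2) :
    Tendsto (fun n => multiplier (m n) (hm n) f) l (𝓝 (multiplier m₀ hm₀ f)) := by
  have key : Tendsto (fun n => ‖multiplier (m n) (hm n) f - multiplier m₀ hm₀ f‖ ^ 2) l
      (𝓝 0) := by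
    have e : ∀ n, ‖multiplier (m n) (hm n) f - multiplier m₀ hm₀ f‖ ^ 2
        = ∑' k, ‖(m n k - m₀ k) * coeffL k f‖ ^ 2 := fun n => by
      rw [← (hasSum_norm_sq_coeffL _).tsum_eq]
      simp only [map_sub, coeffL_multiplier, sub_mul]
    simp only [e]
    have h0 : (0 : ℝ) = ∑' k : ℤ, (0 : ℝ) := by simp
    rw [h0]
    refine tendsto_tsum_of_dominated_convergence (bound := fun k => 4 * ‖coeffL k f‖ ^ 2)
      ((hasSum_norm_sq_coeffL f).summable.mul_left 4) (fun k => ?_)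
      (Eventually.of_forall fun n k => ?_)
    · have := (((h k).sub_const (m₀ k)).mul_const (coeffL k f)).norm.pow 2
      simpa using this
    · rw [Real.norm_of_nonneg (by positivity), norm_mul, mul_pow]
      have h1 : ‖m n k - m₀ k‖ ≤ 2 := by
        linarith [norm_sub_le (m n k) (m₀ k), hm n k, hm₀ k]
      have h2 : ‖m n k - m₀ k‖ ^ 2 ≤ 4 := by nlinarith [norm_nonneg (m n k - m₀ k)]
      gcongr
  have := key.sqrt
  simp only [Real.sqrt_sq (norm_nonneg _), Real.sqrt_zero] at this
  exact tendsto_iff_norm_sub_tendsto_zero.2 this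

/-! ### Multiplication of `L²` by continuous functions -/

/-- Multiplication of an `L²` function by a continuous function. -/
def cmul : C(Torus, ℂ) →L[ℂ] L2 →L[ℂ] L2 :=
  ((ContinuousLinearMap.mul ℂ ℂ).holderL haar ∞ 2 2).comp (ContinuousMap.toLp ∞ haar ℂ)

theorem coeFn_cmul (g : C(Torus, ℂ)) (f : L2) :
    cmul g f =ᵐ[haar] fun x => g x * f x := by
  have h1 := (ContinuousLinearMap.mul ℂ ℂ).coeFn_holder (r := 2)
    (ContinuousMap.toLp (E := ℂ) ∞ haar ℂ g) f
  filter_upwards [h1, ContinuousMap.coeFn_toLp (E := ℂ) (p := ∞) (𝕜 := ℂ) haar g] with x h1 h2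
  change (((ContinuousLinearMap.mul ℂ ℂ).holder 2 (ContinuousMap.toLp (E := ℂ) ∞ haar ℂ g) f :
    L2) : Torus → ℂ) x = _
  rw [h1, h2]; rfl

/-- A continuous function as an element of `L²`. -/
abbrev toL2 : C(Torus, ℂ) →L[ℂ] L2 := ContinuousMap.toLp 2 haar ℂ

theorem coeFn_toL2 (g : C(Torus, ℂ)) : toL2 g =ᵐ[haar] g := ContinuousMap.coeFn_toLp _ _

theorem cmul_toL2 (g h : C(Torus, ℂ)) : cmul g (toL2 h) = toL2 (g * h) := by
  ext1
  filter_upwards [coeFn_cmul g (toL2 h), coeFn_toL2 h, coeFn_toL2 (g * h)] with x h1 h2 h3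
  rw [h1, h2, h3]; rfl

theorem cmul_mul (g h : C(Torus, ℂ)) (f : L2) : cmul (g * h) f = cmul g (cmul h f) := by
  ext1
  filter_upwards [coeFn_cmul g (cmul h f), coeFn_cmul h f, coeFn_cmul (g * h) f] with x h1 h2 h3
  rw [h1, h2, h3, ContinuousMap.mul_apply, mul_assoc]

theorem cmul_one (f : L2) : cmul 1 f = f := by
  ext1
  filter_upwards [coeFn_cmul 1 f] with x h1
  rw [h1, ContinuousMap.one_apply, one_mul]

theorem inner_toL2 (g h : C(Torus, ℂ)) : ⟪toL2 g, toL2 h⟫_ℂ = ∫ x, conj (g x) * h x ∂haar := by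
  rw [L2.inner_def]
  refine integral_congr_ae ?_
  filter_upwards [coeFn_toL2 g, coeFn_toL2 h] with x h1 h2
  rw [h1, h2, RCLike.inner_apply, mul_comm]

theorem inner_cmul_right (g : C(Torus, ℂ)) (f h : L2) :
    ⟪f, cmul g h⟫_ℂ = ⟪cmul (star g) f, h⟫_ℂ := by
  rw [L2.inner_def, L2.inner_def]
  refine integral_congr_ae ?_
  filter_upwards [coeFn_cmul g h, coeFn_cmul (star g) f] with x h1 h2
  rw [h1, h2, RCLike.inner_apply, RCLike.inner_apply, ContinuousMap.star_apply, map_mul,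
    RCLike.star_def, RCLike.conj_conj]
  ring

theorem inner_cmul_left (g : C(Torus, ℂ)) (f h : L2) :
    ⟪cmul g f, h⟫_ℂ = ⟪f, cmul (star g) h⟫_ℂ := by
  rw [inner_cmul_right, star_star]

theorem fourierBasis_eq (k : ℤ) : (fourierBasis k : L2) = toL2 (fourier k) := by
  rw [coe_fourierBasis]

/-- Complex conjugation on `L²`. -/
def conjL2 : L2 →L[ℝ] L2 := (Complex.conjCLE : ℂ →L[ℝ] ℂ).compLpL 2 haar

theorem coeFn_conjL2 (f : L2) : conjL2 f =ᵐ[haar] fun x => conj (f x) :=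
  ContinuousLinearMap.coeFn_compLpL _ _

theorem inner_conjL2 (f g : L2) : ⟪conjL2 f, g⟫_ℂ = ⟪conjL2 g, f⟫_ℂ := by
  rw [L2.inner_def, L2.inner_def]
  refine integral_congr_ae ?_
  filter_upwards [coeFn_conjL2 f, coeFn_conjL2 g] with x h1 h2
  rw [h1, h2, RCLike.inner_apply, RCLike.inner_apply, RCLike.conj_conj, RCLike.conj_conj, mul_comm]

theorem conjL2_toL2 (g : C(Torus, ℂ)) : conjL2 (toL2 g) = toL2 (star g) := by
  ext1
  filter_upwards [coeFn_conjL2 (toL2 g), coeFn_toL2 g, coeFn_toL2 (star g)] with x h1 h2 h3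
  rw [h1, h2, h3]; rfl

theorem inner_conjL2_conjL2 (f g : L2) : ⟪conjL2 f, conjL2 g⟫_ℂ = ⟪g, f⟫_ℂ := by
  rw [inner_conjL2]
  rw [L2.inner_def, L2.inner_def]
  refine integral_congr_ae ?_
  filter_upwards [coeFn_conjL2 g, coeFn_conjL2 (conjL2 g)] with x h1 h2
  rw [h2, h1, RCLike.conj_conj]

theorem coeffL_conjL2 (k : ℤ) (f : L2) : coeffL k (conjL2 f) = conj (coeffL (-k) f) := by
  change ⟪(fourierBasis k : L2), conjL2 f⟫_ℂ = conj ⟪(fourierBasis (-k) : L2), f⟫_ℂ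
  have h : (fourierBasis k : L2) = conjL2 (fourierBasis (-k) : L2) := by
    rw [fourierBasis_eq, fourierBasis_eq, conjL2_toL2]
    congr 1
    ext x
    simp [ContinuousMap.star_apply]
  rw [h, inner_conjL2_conjL2, inner_conj_symm]

theorem cmul_conjL2 (g : C(Torus, ℂ)) (f : L2) : cmul (star g) (conjL2 f) = conjL2 (cmul g f) := by
  ext1
  filter_upwards [coeFn_cmul (star g) (conjL2 f), coeFn_conjL2 f, coeFn_conjL2 (cmul g f),
    coeFn_cmul g f] with x h1 h2 h3 h4
  rw [h1, h2, h3, h4, map_mul]; rfl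

/-! ### The Sobolev space as a Banach space -/

/-- The space `H¹` realized as the closed subspace of pairs `(u, u_x)` in `L² × L²`, which makes it
a Banach space. Its norm is equivalent to `h1Norm`. -/
def sobGraph : Submodule ℂ (L2 × L2) where
  carrier := {z | ∀ k, coeffL k z.2 = Complex.I * k * coeffL k z.1}
  zero_mem' := fun k => by simp
  add_mem' := fun {x y} hx hy k => by
    rw [Prod.snd_add, Prod.fst_add, map_add, map_add, hx k, hy k, mul_add]
  smul_mem' := fun c x hx k => by
    rw [Prod.smul_snd, Prod.smul_fst, map_smul, map_smul, hx k, smul_eq_mul, smul_eq_mul]; ring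

/-- The Sobolev space `H¹`, as a space of pairs `(u, u_x)`. -/
def Sob : Type := sobGraph

instance : NormedAddCommGroup Sob := inferInstanceAs (NormedAddCommGroup sobGraph)

instance : NormedSpace ℂ Sob := inferInstanceAs (NormedSpace ℂ sobGraph)

theorem isClosed_sobGraph : IsClosed (sobGraph : Set (L2 × L2)) := by
  have : (sobGraph : Set (L2 × L2))
      = ⋂ k : ℤ, {z : L2 × L2 | coeffL k z.2 = Complex.I * k * coeffL k z.1} := by
    ext z; simp [sobGraph]
  rw [this]
  exact isClosed_iInter fun k => isClosed_eq (by fun_prop) (by fun_prop)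

instance : CompleteSpace Sob := isClosed_sobGraph.completeSpace_coe

/-- The inclusion of `H¹` in `L² × L²`. -/
def pairL : Sob →L[ℂ] L2 × L2 := sobGraph.subtypeL

theorem isInducing_pairL : IsInducing pairL := IsInducing.subtypeVal

/-- A continuous linear map with values in the pairs `(u, u_x)` is one into `H¹`. -/
def codSob {E : Type*} [NormedAddCommGroup E] [NormedSpace ℝ E] (A : E →L[ℝ] L2 × L2)
    (h : ∀ x, A x ∈ sobGraph) : E →L[ℝ] Sob where
  toFun x := ⟨A x, h x⟩
  map_add' x y := Subtype.ext (map_add A x y)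
  map_smul' c x := Subtype.ext (map_smul A c x)
  cont := A.continuous.subtype_mk h

/-- The inclusion of `H¹` in `L²`. -/
def fn : Sob →L[ℂ] L2 := (ContinuousLinearMap.fst ℂ L2 L2).comp pairL

/-- The derivative `H¹ → L²`. -/
def dx : Sob →L[ℂ] L2 := (ContinuousLinearMap.snd ℂ L2 L2).comp pairL

theorem coeffL_dx (k : ℤ) (u : Sob) : coeffL k (dx u) = Complex.I * k * coeffL k (fn u) := u.2 k

theorem fn_injective : Function.Injective fn := fun u v h => by
  refine Subtype.ext (Prod.ext h (ext_coeffL fun k => ?_))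
  change coeffL k (dx u) = coeffL k (dx v)
  rw [coeffL_dx, coeffL_dx, h]

theorem norm_sob (u : Sob) : ‖u‖ = max ‖fn u‖ ‖dx u‖ := rfl

theorem norm_fn_le (u : Sob) : ‖fn u‖ ≤ ‖u‖ := le_max_left _ _

theorem norm_dx_le (u : Sob) : ‖dx u‖ ≤ ‖u‖ := le_max_right _ _

theorem sob_tendsto_iff {α : Type*} {l : Filter α} {F : α → Sob} {u : Sob} :
    Tendsto F l (𝓝 u) ↔
      Tendsto (fun n => fn (F n)) l (𝓝 (fn u)) ∧ Tendsto (fun n => dx (F n)) l (𝓝 (dx u)) := by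
  refine ⟨fun h => ⟨(fn.continuous.tendsto u).comp h, (dx.continuous.tendsto u).comp h⟩,
    fun h => isInducing_pairL.tendsto_nhds_iff.2 ((Prod.tendsto_iff _ _).2 h)⟩

/-- The element of `H¹` with given value and derivative. -/
def mkSob (f g : L2) (h : ∀ k, coeffL k g = Complex.I * k * coeffL k f) : Sob := ⟨(f, g), h⟩

@[simp] theorem fn_mkSob (f g : L2) (h) : fn (mkSob f g h) = f := rfl

@[simp] theorem dx_mkSob (f g : L2) (h) : dx (mkSob f g h) = g := rfl

/-- The exponential `e^{ikx}` as an element of `H¹`. -/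
def expo (k : ℤ) : Sob :=
  mkSob (fourierBasis k) ((Complex.I * k) • (fourierBasis k : L2)) fun l => by
    rw [map_smul, coeffL_fourierBasis, smul_eq_mul]
    split_ifs with h
    · rw [h]
    · simp

theorem fn_expo (k : ℤ) : fn (expo k) = fourierBasis k := rfl

theorem dx_expo (k : ℤ) : dx (expo k) = (Complex.I * k) • (fourierBasis k : L2) := rfl

theorem hasSum_expo (u : Sob) : HasSum (fun k => coeffL k (fn u) • expo k) u := by
  refine sob_tendsto_iff.2 ⟨?_, ?_⟩
  · simp only [map_sum, map_smul, fn_expo]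
    exact hasSum_fourierBasis (fn u)
  · simp only [map_sum, map_smul, dx_expo, smul_smul]
    have h := hasSum_fourierBasis (dx u)
    simp only [coeffL_dx, mul_comm (Complex.I * _)] at h
    exact h

/-- Continuous linear maps on `H¹` are determined by their values on exponentials. -/
theorem clm_ext_expo {E : Type*} [NormedAddCommGroup E] [NormedSpace ℂ E] {A B : Sob →L[ℂ] E}
    (h : ∀ k, A (expo k) = B (expo k)) : A = B := by
  ext u
  refine ((hasSum_expo u).mapL A).unique ?_
  simpa only [map_smul, h] using (hasSum_expo u).mapL B

/-- The Fourier multiplier with symbol `m`, acting on `H¹`. -/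
def sobMultiplier (m : ℤ → ℂ) (hm : ∀ k, ‖m k‖ ≤ 1) : Sob →L[ℂ] Sob :=
  ContinuousLinearMap.codRestrict (((multiplier m hm).comp fn).prod ((multiplier m hm).comp dx))
      sobGraph fun u k => by
    change coeffL k (multiplier m hm (dx u)) = _ * coeffL k (multiplier m hm (fn u))
    rw [coeffL_multiplier, coeffL_multiplier, coeffL_dx]
    ring

@[simp] theorem fn_sobMultiplier (m : ℤ → ℂ) (hm : ∀ k, ‖m k‖ ≤ 1) (u : Sob) :
    fn (sobMultiplier m hm u) = multiplier m hm (fn u) := rfl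

theorem norm_sobMultiplier_le (m : ℤ → ℂ) (hm : ∀ k, ‖m k‖ ≤ 1) (u : Sob) :
    ‖sobMultiplier m hm u‖ ≤ ‖u‖ :=
  max_le_max (norm_multiplier_le m hm _) (norm_multiplier_le m hm _)

theorem tendsto_sobMultiplier {α : Type*} {l : Filter α} [l.IsCountablyGenerated]
    {m : α → ℤ → ℂ} {m₀ : ℤ → ℂ} (hm : ∀ n k, ‖m n k‖ ≤ 1) (hm₀ : ∀ k, ‖m₀ k‖ ≤ 1)
    (h : ∀ k, Tendsto (fun n => m n k) l (𝓝 (m₀ k))) (u : Sob) :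
    Tendsto (fun n => sobMultiplier (m n) (hm n) u) l (𝓝 (sobMultiplier m₀ hm₀ u)) :=
  sob_tendsto_iff.2 ⟨tendsto_multiplier hm hm₀ h _, tendsto_multiplier hm hm₀ h _⟩

/-! ### The identification with `H1` -/

theorem coeffL_weakDeriv (u : H1) (k : ℤ) :
    coeffL k (weakDeriv u) = Complex.I * k * coeffL k (u : L2) := by
  rw [weakDeriv, coeffL_repr_symm, coeffL_apply]

/-- The identification of `H1` with `Sob`. -/
def toSob : H1 →ₗ[ℂ] Sob where
  toFun u := mkSob u (weakDeriv u) (coeffL_weakDeriv u)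
  map_add' _ _ := fn_injective rfl
  map_smul' _ _ := fn_injective rfl

theorem fn_toSob (u : H1) : fn (toSob u) = u := rfl

theorem dx_toSob (u : H1) : dx (toSob u) = weakDeriv u := rfl

/-- The inverse identification of `Sob` with `H1`. -/
def ofSob (u : Sob) : H1 := ⟨fn u, by
  have h := (hasSum_norm_sq_coeffL (fn u)).summable.add (hasSum_norm_sq_coeffL (dx u)).summable
  refine h.congr fun k => ?_
  rw [coeffL_dx, coeffL_apply, norm_mul, norm_mul, Complex.norm_I, Complex.norm_intCast, one_mul,
    mul_pow, sq_abs]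
  ring⟩

@[simp] theorem toSob_ofSob (u : Sob) : toSob (ofSob u) = u := fn_injective rfl

@[simp] theorem ofSob_toSob (u : H1) : ofSob (toSob u) = u := rfl

theorem h1Norm_eq (u : H1) :
    h1Norm u = √(2 * π * (‖fn (toSob u)‖ ^ 2 + ‖dx (toSob u)‖ ^ 2)) := by
  have h := (hasSum_norm_sq_coeffL (fn (toSob u))).add (hasSum_norm_sq_coeffL (dx (toSob u)))
  rw [h1Norm, ← h.tsum_eq]
  congr 3
  funext k
  rw [coeffL_dx, norm_mul, norm_mul, Complex.norm_I, Complex.norm_intCast, one_mul, mul_pow, sq_abs,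
    coeffL_apply, fn_toSob]
  ring

theorem h1Norm_le (u : H1) : h1Norm u ≤ √(4 * π) * ‖toSob u‖ := by
  rw [h1Norm_eq, ← Real.sqrt_sq (norm_nonneg (toSob u)), ← Real.sqrt_mul (by positivity)]
  refine Real.sqrt_le_sqrt ?_
  have h1 := pow_le_pow_left₀ (norm_nonneg _) (norm_fn_le (toSob u)) 2
  have h2 := pow_le_pow_left₀ (norm_nonneg _) (norm_dx_le (toSob u)) 2
  have := Real.pi_pos
  nlinarith

theorem norm_toSob_le (u : H1) : ‖toSob u‖ ≤ h1Norm u := by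
  have hp := Real.pi_gt_three
  rw [h1Norm_eq, norm_sob]
  have h1 := sq_nonneg ‖fn (toSob u)‖
  have h2 := sq_nonneg ‖dx (toSob u)‖
  refine max_le (Real.le_sqrt_of_sq_le ?_) (Real.le_sqrt_of_sq_le ?_) <;> nlinarith

/-! ### Continuous representatives and the algebra structure -/

theorem exists_continuous (u : Sob) : ∃ g : C(Torus, ℂ), toL2 g = fn u := by
  obtain ⟨g, hg⟩ := h1_exists_continuous (ofSob u)
  refine ⟨g, ?_⟩
  ext1
  exact (coeFn_toL2 g).trans hg.symm

theorem toL2_injective : Function.Injective toL2 := ContinuousMap.toLp_injective haar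

/-- The continuous representative of an element of `H¹`. -/
def contRep (u : Sob) : C(Torus, ℂ) := (exists_continuous u).choose

theorem toL2_contRep (u : Sob) : toL2 (contRep u) = fn u := (exists_continuous u).choose_spec

/-- The embedding of `H¹` in the continuous functions. It is bounded by the closed graph theorem. -/
def cont : Sob →L[ℂ] C(Torus, ℂ) :=
  ContinuousLinearMap.ofSeqClosedGraph
    (g := { toFun := contRep
            map_add' := fun u v => toL2_injective <| by
              rw [map_add]; simp only [toL2_contRep, map_add]
            map_smul' := fun c u => toL2_injective <| by
              rw [map_smul]; simp only [toL2_contRep, map_smul, RingHom.id_apply] })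
    fun s u g hs hg => toL2_injective <| by
      have h1 := (toL2.continuous.tendsto g).comp hg
      have h2 := (fn.continuous.tendsto u).comp hs
      exact (tendsto_nhds_unique h1 (h2.congr fun n => (toL2_contRep (s n)).symm)).trans
        (toL2_contRep u).symm

theorem toL2_cont (u : Sob) : toL2 (cont u) = fn u := toL2_contRep u

theorem cont_eq_of_fn {u : Sob} {g : C(Torus, ℂ)} (h : fn u = toL2 g) : cont u = g :=
  toL2_injective ((toL2_cont u).trans h)

theorem cont_injective : Function.Injective cont := fun u v h =>
  fn_injective (by rw [← toL2_cont, ← toL2_cont, h])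

theorem coeFn_fn (u : Sob) : fn u =ᵐ[haar] cont u := by
  rw [← toL2_cont]; exact coeFn_toL2 _

theorem cont_expo (k : ℤ) : cont (expo k) = fourier k :=
  cont_eq_of_fn (by rw [fn_expo, fourierBasis_eq])

theorem cmul_fourier_fourierBasis (k l : ℤ) :
    cmul (fourier k) (fourierBasis l : L2) = fourierBasis (k + l) := by
  rw [fourierBasis_eq, fourierBasis_eq, cmul_toL2]
  congr 1
  ext x
  rw [ContinuousMap.mul_apply, fourier_add]

/-- The derivative `u v_x + v u_x` of a product. -/
def leibniz : Sob →L[ℂ] Sob →L[ℂ] L2 :=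
  cmul.bilinearComp cont dx + (cmul.bilinearComp cont dx).flip

theorem leibniz_apply (u v : Sob) :
    leibniz u v = cmul (cont u) (dx v) + cmul (cont v) (dx u) := rfl

/-- By bilinearity and density, the product rule follows from the case of exponentials. -/
theorem coeffL_leibniz (u v : Sob) (k : ℤ) :
    coeffL k (leibniz u v) = Complex.I * k * coeffL k (cmul (cont u) (fn v)) := by
  let A : Sob →L[ℂ] Sob →L[ℂ] ℂ := (ContinuousLinearMap.compL ℂ Sob L2 ℂ (coeffL k)).comp leibniz
  let B : Sob →L[ℂ] Sob →L[ℂ] ℂ := (ContinuousLinearMap.compL ℂ Sob L2 ℂ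
    ((Complex.I * k) • coeffL k)).comp (cmul.bilinearComp cont fn)
  suffices h : A = B from DFunLike.congr_fun (DFunLike.congr_fun h u) v
  refine clm_ext_expo (A := A) (B := B) fun i =>
    clm_ext_expo (A := A (expo i)) (B := B (expo i)) fun j => ?_
  change coeffL k (leibniz (expo i) (expo j))
    = Complex.I * k * coeffL k (cmul (cont (expo i)) (fn (expo j)))
  rw [leibniz_apply, cont_expo, cont_expo, dx_expo, dx_expo, fn_expo, map_smul, map_smul,
    cmul_fourier_fourierBasis, cmul_fourier_fourierBasis, add_comm j i, ← add_smul, map_smul,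
    coeffL_fourierBasis, smul_eq_mul]
  split_ifs with h
  · subst h; push_cast; ring
  · simp

/-- The product of two elements of `H¹`. -/
def mulFun (u v : Sob) : Sob := mkSob (cmul (cont u) (fn v)) (leibniz u v) (coeffL_leibniz u v)

/-- Multiplication on `H¹`, as a continuous bilinear map. -/
def mulS : Sob →L[ℂ] Sob →L[ℂ] Sob :=
  LinearMap.mkContinuous₂
    (LinearMap.mk₂ ℂ mulFun
      (fun u v w => fn_injective (by simp [mulFun])) (fun c u v => fn_injective (by simp [mulFun]))
      (fun u v w => fn_injective (by simp [mulFun])) (fun c u v => fn_injective (by simp [mulFun])))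
    (max ‖cmul.bilinearComp cont fn‖ ‖leibniz‖) fun u v => by
      rw [LinearMap.mk₂_apply, norm_sob, mulFun, fn_mkSob, dx_mkSob]
      refine max_le ?_ ?_
      · refine ((cmul.bilinearComp cont fn).le_opNorm₂ u v).trans ?_
        gcongr; exact le_max_left _ _
      · refine (leibniz.le_opNorm₂ u v).trans ?_
        gcongr; exact le_max_right _ _

theorem fn_mulS (u v : Sob) : fn (mulS u v) = cmul (cont u) (fn v) := rfl

theorem dx_mulS (u v : Sob) :
    dx (mulS u v) = cmul (cont u) (dx v) + cmul (cont v) (dx u) := rfl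

@[simp] theorem cont_mulS (u v : Sob) : cont (mulS u v) = cont u * cont v :=
  cont_eq_of_fn (by rw [fn_mulS, ← toL2_cont v, cmul_toL2])

/-- Complex conjugation on `H¹`. -/
def conjS : Sob →L[ℝ] Sob :=
  codSob ((conjL2.comp (fn.restrictScalars ℝ)).prod (conjL2.comp (dx.restrictScalars ℝ)))
    fun u k => by
      change coeffL k (conjL2 (dx u)) = Complex.I * k * coeffL k (conjL2 (fn u))
      rw [coeffL_conjL2, coeffL_conjL2, coeffL_dx]
      simp

theorem fn_conjS (u : Sob) : fn (conjS u) = conjL2 (fn u) := rfl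

theorem dx_conjS (u : Sob) : dx (conjS u) = conjL2 (dx u) := rfl

@[simp] theorem cont_conjS (u : Sob) : cont (conjS u) = star (cont u) :=
  cont_eq_of_fn (by rw [fn_conjS, ← toL2_cont u, conjL2_toL2])

/-- The constant function `1`. -/
def oneS : Sob := expo 0

@[simp] theorem cont_oneS : cont oneS = 1 := by
  rw [oneS, cont_expo]; ext x; simp

@[simp] theorem dx_oneS : dx oneS = 0 := by rw [oneS, dx_expo]; simp

/-- Powers of an element of `H¹`. -/
def powS (u : Sob) : ℕ → Sob
  | 0 => oneS
  | n + 1 => mulS u (powS u n)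

@[simp] theorem cont_powS (u : Sob) (n : ℕ) : cont (powS u n) = cont u ^ n := by
  induction n with
  | zero => simp [powS]
  | succ n ih => rw [powS, cont_mulS, ih, pow_succ']

theorem dx_powS_succ (u : Sob) (n : ℕ) :
    dx (powS u (n + 1)) = ((n : ℂ) + 1) • cmul (cont u ^ n) (dx u) := by
  induction n with
  | zero => simp [powS, dx_mulS, cmul_one]
  | succ n ih =>
    rw [powS, dx_mulS, ih, cont_powS, map_smul, ← cmul_mul, ← pow_succ', Nat.cast_succ,
      add_smul ((n : ℂ) + 1), one_smul]

/-- Integration by parts. -/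
theorem inner_dx_left (u v : Sob) : ⟪dx u, fn v⟫_ℂ = -⟪fn u, dx v⟫_ℂ := by
  refine (hasSum_inner_coeffL _ _).unique ?_
  refine (hasSum_inner_coeffL (fn u) (dx v)).neg.congr_fun fun k => ?_
  rw [coeffL_dx, coeffL_dx]
  simp
  ring

/-! ### The Schrödinger group on `H¹` -/

theorem norm_schrodingerSymbol_le (t : ℝ) (k : ℤ) :
    ‖Complex.exp (-Complex.I * (k : ℂ) ^ 2 * (t : ℂ))‖ ≤ 1 := by
  have h : -Complex.I * (k : ℂ) ^ 2 * (t : ℂ) = ((-(k : ℝ) ^ 2 * t : ℝ) : ℂ) * Complex.I := by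
    push_cast; ring
  rw [h, Complex.norm_exp_ofReal_mul_I]

theorem freeGroup_eq (t : ℝ) (f : L2) :
    freeGroup t f = multiplier _ (norm_schrodingerSymbol_le t) f :=
  ext_coeffL fun k => by
    rw [coeffL_multiplier, freeGroup, coeffL_repr_symm, coeffL_apply]

/-- The free Schrödinger group on `H¹`. -/
def grp (t : ℝ) : Sob →L[ℂ] Sob := sobMultiplier _ (norm_schrodingerSymbol_le t)

theorem fn_grp (t : ℝ) (u : Sob) : fn (grp t u) = freeGroup t (fn u) := by
  rw [freeGroup_eq]; rfl

theorem coeffL_grp (t : ℝ) (u : Sob) (k : ℤ) :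
    coeffL k (fn (grp t u)) = Complex.exp (-Complex.I * (k : ℂ) ^ 2 * (t : ℂ)) * coeffL k (fn u) :=
  coeffL_multiplier _ (norm_schrodingerSymbol_le t) _ k

theorem grp_grp (s t : ℝ) (u : Sob) : grp s (grp t u) = grp (s + t) u :=
  fn_injective <| ext_coeffL fun k => by
    rw [coeffL_grp, coeffL_grp, coeffL_grp, ← mul_assoc, ← Complex.exp_add]
    push_cast; ring_nf

@[simp] theorem grp_zero (u : Sob) : grp 0 u = u :=
  fn_injective <| ext_coeffL fun k => by rw [coeffL_grp]; simp

@[simp] theorem grp_neg_grp (t : ℝ) (u : Sob) : grp (-t) (grp t u) = u := by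
  rw [grp_grp, neg_add_cancel, grp_zero]

@[simp] theorem grp_grp_neg (t : ℝ) (u : Sob) : grp t (grp (-t) u) = u := by
  rw [grp_grp, add_neg_cancel, grp_zero]

theorem norm_grp_le (t : ℝ) (u : Sob) : ‖grp t u‖ ≤ ‖u‖ := norm_sobMultiplier_le _ _ _

@[simp] theorem norm_grp (t : ℝ) (u : Sob) : ‖grp t u‖ = ‖u‖ :=
  le_antisymm (norm_grp_le t u) <| by simpa using norm_grp_le (-t) (grp t u)

/-- Joint continuity of the group. -/
theorem tendsto_grp {α : Type*} {l : Filter α} [l.IsCountablyGenerated] {r : α → ℝ} {r₀ : ℝ}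
    {y : α → Sob} {y₀ : Sob} (hr : Tendsto r l (𝓝 r₀)) (hy : Tendsto y l (𝓝 y₀)) :
    Tendsto (fun n => grp (r n) (y n)) l (𝓝 (grp r₀ y₀)) := by
  have h1 : Tendsto (fun n => grp (r n) y₀) l (𝓝 (grp r₀ y₀)) := by
    refine tendsto_sobMultiplier (fun n => norm_schrodingerSymbol_le (r n))
      (norm_schrodingerSymbol_le r₀) (fun k => ?_) y₀
    have hc : Continuous fun t : ℝ => Complex.exp (-Complex.I * (k : ℂ) ^ 2 * (t : ℂ)) := by
      fun_prop
    exact (hc.tendsto r₀).comp hr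
  have h2 : Tendsto (fun n => grp (r n) (y n - y₀)) l (𝓝 0) := by
    rw [tendsto_zero_iff_norm_tendsto_zero]
    simpa only [norm_grp] using tendsto_iff_norm_sub_tendsto_zero.1 hy
  simpa using h2.add h1

theorem continuousOn_grp {r : ℝ → ℝ} {y : ℝ → Sob} {s : Set ℝ} (hr : ContinuousOn r s)
    (hy : ContinuousOn y s) : ContinuousOn (fun t => grp (r t) (y t)) s :=
  fun t ht => tendsto_grp (hr t ht) (hy t ht)

theorem continuous_grp {r : ℝ → ℝ} {y : ℝ → Sob} (hr : Continuous r) (hy : Continuous y) :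
    Continuous (fun t => grp (r t) (y t)) :=
  continuous_iff_continuousAt.2 fun _ => tendsto_grp hr.continuousAt hy.continuousAt

/-! ### The nonlinearity -/

/-- Lipschitz continuity on every ball. -/
def LipOnBalls {E F : Type*} [NormedAddCommGroup E] [NormedAddCommGroup F] (G : E → F) : Prop :=
  ∀ R : ℝ, 0 ≤ R → ∃ C : ℝ, 0 ≤ C ∧
    ∀ u v, ‖u‖ ≤ R → ‖v‖ ≤ R → ‖G u - G v‖ ≤ C * ‖u - v‖

section LipOnBalls

variable {E F : Type*} [NormedAddCommGroup E] [NormedAddCommGroup F]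

theorem LipOnBalls.bounded {G : E → F} (h : LipOnBalls G) (R : ℝ) (hR : 0 ≤ R) :
    ∃ B : ℝ, 0 ≤ B ∧ ∀ u, ‖u‖ ≤ R → ‖G u‖ ≤ B := by
  obtain ⟨C, hC, h⟩ := h R hR
  refine ⟨C * R + ‖G 0‖, by positivity, fun u hu => ?_⟩
  have h1 := h u 0 hu (by simpa using hR)
  rw [sub_zero] at h1
  have h2 := norm_add_le (G u - G 0) (G 0)
  rw [sub_add_cancel] at h2
  nlinarith

theorem LipOnBalls.continuous {G : E → F} (h : LipOnBalls G) : Continuous G := by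
  refine continuous_iff_continuousAt.2 fun u => ?_
  obtain ⟨C, hC, h⟩ := h (‖u‖ + 1) (by positivity)
  rw [ContinuousAt, tendsto_iff_norm_sub_tendsto_zero]
  have h0 : Tendsto (fun v => C * ‖v - u‖) (𝓝 u) (𝓝 0) := by
    simpa using (tendsto_iff_norm_sub_tendsto_zero.1 (tendsto_id (α := E) (x := 𝓝 u))).const_mul C
  refine squeeze_zero' (Eventually.of_forall fun _ => norm_nonneg _) ?_ h0
  have : ∀ᶠ v in 𝓝 u, ‖v‖ < ‖u‖ + 1 := continuous_norm.continuousAt.eventually_lt_const (by simp)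
  filter_upwards [this] with v hv
  exact h v u hv.le (by simp)

theorem LipOnBalls.sub {G H : E → F} (hG : LipOnBalls G) (hH : LipOnBalls H) :
    LipOnBalls fun u => G u - H u := fun R hR => by
  obtain ⟨C, hC, h1⟩ := hG R hR
  obtain ⟨D, hD, h2⟩ := hH R hR
  refine ⟨C + D, by positivity, fun u v hu hv => ?_⟩
  have e : G u - H u - (G v - H v) = (G u - G v) - (H u - H v) := by abel
  rw [e, add_mul]
  exact (norm_sub_le _ _).trans (add_le_add (h1 u v hu hv) (h2 u v hu hv))

theorem LipOnBalls.of_clm [NormedSpace ℝ E] [NormedSpace ℝ F] (A : E →L[ℝ] F) : LipOnBalls A :=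
  fun _ _ => ⟨‖A‖, norm_nonneg _, fun u v _ _ => by rw [← map_sub]; exact A.le_opNorm _⟩

theorem LipOnBalls.const (c : F) : LipOnBalls fun _ : E => c :=
  fun _ _ => ⟨0, le_rfl, fun u v _ _ => by simp⟩

/-- A bounded biadditive map composed with functions that are Lipschitz on balls. -/
theorem LipOnBalls.biadd {F₁ F₂ : Type*} [NormedAddCommGroup F₁] [NormedAddCommGroup F₂]
    {B : F₁ → F₂ → F} {K : ℝ} (hK : 0 ≤ K) (hl : ∀ x y z, B (x - y) z = B x z - B y z)
    (hr : ∀ x y z, B x (y - z) = B x y - B x z) (hB : ∀ x y, ‖B x y‖ ≤ K * ‖x‖ * ‖y‖)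
    {G₁ : E → F₁} {G₂ : E → F₂} (h₁ : LipOnBalls G₁) (h₂ : LipOnBalls G₂) :
    LipOnBalls fun u => B (G₁ u) (G₂ u) := fun R hR => by
  obtain ⟨C, hC, hL₁⟩ := h₁ R hR
  obtain ⟨D, hD, hL₂⟩ := h₂ R hR
  obtain ⟨M, hM, hB₁⟩ := h₁.bounded R hR
  obtain ⟨N, hN, hB₂⟩ := h₂.bounded R hR
  refine ⟨K * C * N + K * M * D, by positivity, fun u v hu hv => ?_⟩
  have e : B (G₁ u) (G₂ u) - B (G₁ v) (G₂ v)
      = B (G₁ u - G₁ v) (G₂ u) + B (G₁ v) (G₂ u - G₂ v) := by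
    rw [hl, hr]; abel
  rw [e]
  calc _ ≤ K * ‖G₁ u - G₁ v‖ * ‖G₂ u‖ + K * ‖G₁ v‖ * ‖G₂ u - G₂ v‖ :=
        (norm_add_le _ _).trans (add_le_add (hB _ _) (hB _ _))
    _ ≤ K * (C * ‖u - v‖) * N + K * M * (D * ‖u - v‖) := by
        gcongr
        exacts [hL₁ u v hu hv, hB₂ u hu, hB₁ v hv, hL₂ u v hu hv]
    _ = _ := by ring

theorem LipOnBalls.bilin {F₁ F₂ F₃ : Type*} [NormedAddCommGroup F₁] [NormedAddCommGroup F₂]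
    [NormedAddCommGroup F₃] [NormedSpace ℂ F₁] [NormedSpace ℂ F₂] [NormedSpace ℂ F₃]
    (B : F₁ →L[ℂ] F₂ →L[ℂ] F₃) {G₁ : E → F₁} {G₂ : E → F₂} (h₁ : LipOnBalls G₁)
    (h₂ : LipOnBalls G₂) : LipOnBalls fun u => B (G₁ u) (G₂ u) :=
  LipOnBalls.biadd (B := fun x y => B x y) (norm_nonneg B) (fun _ _ _ => by simp)
    (fun _ _ _ => by simp) B.le_opNorm₂ h₁ h₂

theorem LipOnBalls.comp {F₁ : Type*} [NormedAddCommGroup F₁] {H : F₁ → F} {G : E → F₁}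
    (hH : LipOnBalls H) (hG : LipOnBalls G) : LipOnBalls fun u => H (G u) := fun R hR => by
  obtain ⟨C, hC, h₁⟩ := hG R hR
  obtain ⟨M, hM, h₂⟩ := hG.bounded R hR
  obtain ⟨D, hD, h₃⟩ := hH M hM
  refine ⟨D * C, by positivity, fun u v hu hv => ?_⟩
  refine (h₃ _ _ (h₂ u hu) (h₂ v hv)).trans ?_
  rw [mul_assoc]
  gcongr
  exact h₁ u v hu hv

end LipOnBalls

/-- `|u|²` as an element of `H¹`. -/
def sqS (u : Sob) : Sob := mulS u (conjS u)

/-- The nonlinearity `|u|^(2m) u`. -/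
def nonlin (m : ℕ) (u : Sob) : Sob := mulS u (powS (sqS u) m)

/-- The lower-order part `-a u - i |u|^(2m) u` of the equation, as a map from `H¹` to itself. -/
def field (aS : Sob) (m : ℕ) (u : Sob) : Sob := -mulS aS u - Complex.I • nonlin m u

theorem cont_sqS (u : Sob) : cont (sqS u) = cont u * star (cont u) := by
  rw [sqS, cont_mulS, cont_conjS]

theorem cont_nonlin (m : ℕ) (u : Sob) :
    cont (nonlin m u) = cont u * (cont u * star (cont u)) ^ m := by
  rw [nonlin, cont_mulS, cont_powS, cont_sqS]

theorem lipOnBalls_sqS : LipOnBalls sqS :=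
  LipOnBalls.bilin mulS (LipOnBalls.of_clm (ContinuousLinearMap.id ℝ Sob))
    (LipOnBalls.of_clm conjS)

theorem lipOnBalls_powS {G : Sob → Sob} (hG : LipOnBalls G) (n : ℕ) :
    LipOnBalls fun u => powS (G u) n := by
  induction n with
  | zero => exact LipOnBalls.const oneS
  | succ n ih => exact LipOnBalls.bilin mulS hG ih

theorem lipOnBalls_nonlin (m : ℕ) : LipOnBalls (nonlin m) :=
  LipOnBalls.bilin mulS (LipOnBalls.of_clm (ContinuousLinearMap.id ℝ Sob))
    (lipOnBalls_powS lipOnBalls_sqS m)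

theorem lipOnBalls_field (aS : Sob) (m : ℕ) : LipOnBalls (field aS m) := by
  refine LipOnBalls.sub (LipOnBalls.of_clm ((-mulS aS).restrictScalars ℝ)) ?_
  obtain h := lipOnBalls_nonlin m
  intro R hR
  obtain ⟨C, hC, h⟩ := h R hR
  refine ⟨C, hC, fun u v hu hv => ?_⟩
  rw [← smul_sub, norm_smul, Complex.norm_I, one_mul]
  exact h u v hu hv

/-- Real-valued continuous functions, regarded as complex-valued. -/
def ofRealC (a : C(Torus, ℝ)) : C(Torus, ℂ) := ⟨fun x => (a x : ℂ), by fun_prop⟩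

@[simp] theorem ofRealC_apply (a : C(Torus, ℝ)) (x : Torus) : ofRealC a x = (a x : ℂ) := rfl

@[simp] theorem star_ofRealC (a : C(Torus, ℝ)) : star (ofRealC a) = ofRealC a := by
  ext x; simp [ContinuousMap.star_apply]

theorem fn_field {a : C(Torus, ℝ)} {aS : Sob} (ha : cont aS = ofRealC a) (m : ℕ) (u : H1) :
    fn (field aS m (toSob u)) = drift a (2 * m + 1) u := by
  rw [← toL2_cont]
  ext1
  refine (coeFn_toL2 _).trans ?_
  filter_upwards [MemLp.coeFn_toLp (memLp_drift a (2 * m + 1) u), coeFn_fn (toSob u)] with x h1 h2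
  rw [drift, h1, ← fn_toSob, h2]
  simp only [field, map_sub, map_neg, cont_mulS, map_smul, cont_nonlin, ha]
  simp only [ContinuousMap.sub_apply, ContinuousMap.neg_apply, ContinuousMap.mul_apply,
    ContinuousMap.smul_apply, ContinuousMap.pow_apply, ContinuousMap.star_apply, ofRealC_apply,
    smul_eq_mul, RCLike.star_def, Complex.mul_conj', Nat.add_sub_cancel]
  ring

/-! ### Antiderivatives and smooth coefficients -/

/-- A function of mean zero in `L²` is the derivative of an element of `H¹`. -/
theorem exists_dx_eq {f : L2} (hf : coeffL 0 f = 0) : ∃ u : Sob, dx u = f := by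
  have hm : ∀ k : ℤ, ‖(Complex.I * (k : ℂ))⁻¹‖ ≤ 1 := fun k => by
    rw [norm_inv, norm_mul, Complex.norm_I, one_mul, Complex.norm_intCast]
    rcases eq_or_ne k 0 with rfl | hk
    · simp
    · exact inv_le_one_of_one_le₀ (by exact_mod_cast Int.one_le_abs hk)
  refine ⟨mkSob (multiplier _ hm f) f fun k => ?_, rfl⟩
  rw [coeffL_multiplier]
  rcases eq_or_ne k 0 with rfl | hk
  · simp [hf]
  · have : Complex.I * (k : ℂ) ≠ 0 := mul_ne_zero Complex.I_ne_zero (by exact_mod_cast hk)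
    field_simp

theorem coeffL_toL2 (g : C(Torus, ℂ)) (k : ℤ) : coeffL k (toL2 g) = fourierCoeff g k := by
  rw [coeffL_apply]; exact fourierCoeff_toLp g k

/-- Continuously differentiable functions on the circle belong to `H¹`. -/
theorem exists_sob_of_hasDerivAt {g g' : C(Torus, ℂ)}
    (h : ∀ x : ℝ, HasDerivAt (fun x : ℝ => g (x : Torus)) (g' (x : Torus)) x) :
    ∃ u : Sob, cont u = g ∧ dx u = toL2 g' := by
  have hp := Real.two_pi_pos
  have hc (g : C(Torus, ℂ)) : Continuous fun x : ℝ => g (x : Torus) :=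
    g.continuous.comp (AddCircle.continuous_mk' _)
  have key : ∀ k, coeffL k (toL2 g') = Complex.I * k * coeffL k (toL2 g) := by
    intro k
    rw [coeffL_toL2, coeffL_toL2]
    have hper (g : C(Torus, ℂ)) : g ((0 + 2 * π : ℝ) : Torus) = g ((0 : ℝ) : Torus) := by
      rw [AddCircle.coe_add_period]
    rcases eq_or_ne k 0 with rfl | hk
    · rw [fourierCoeff_eq_intervalIntegral g' 0 0]
      have : ∫ x in (0 : ℝ)..0 + 2 * π, g' (x : Torus) = 0 := by
        rw [intervalIntegral.integral_eq_sub_of_hasDerivAt (fun x _ => h x)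
          ((hc g').intervalIntegrable _ _), hper, sub_self]
      simp only [neg_zero, fourier_zero, one_smul, Int.cast_zero, mul_zero, zero_mul]
      rw [this, smul_zero]
    · have e := fourierCoeffOn_of_hasDerivAt (a := 0) (b := 0 + 2 * π) (by linarith) hk
        (fun x _ => h x) ((hc g').intervalIntegrable _ _)
      have e1 (g : C(Torus, ℂ)) : fourierCoeffOn (a := 0) (b := 0 + 2 * π) (by linarith)
          (fun x : ℝ => g (x : Torus)) k = fourierCoeff g k := by
        rw [fourierCoeffOn_eq_integral, fourierCoeff_eq_intervalIntegral g k 0]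
        simp
      rw [e1, e1, hper, sub_self, mul_zero] at e
      rw [e]
      have h1 : (k : ℂ) ≠ 0 := by exact_mod_cast hk
      have h2 : (π : ℂ) ≠ 0 := by exact_mod_cast Real.pi_ne_zero
      have h3 := Complex.I_ne_zero
      push_cast
      field_simp
      ring_nf
  exact ⟨mkSob _ _ key, cont_eq_of_fn rfl, rfl⟩

/-! ### Mild solutions and differentiation of functionals along them -/

/-- The mild solution of `u_t = i u_xx + f`, `u(0) = x₀`. -/
def mild (x₀ : Sob) (f : ℝ → Sob) (t : ℝ) : Sob :=
  grp t (x₀ + ∫ τ in (0 : ℝ)..t, grp (-τ) (f τ))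

theorem hasDerivAt_interaction (x₀ : Sob) {f : ℝ → Sob} (hf : Continuous f) (t : ℝ) :
    HasDerivAt (fun t => x₀ + ∫ τ in (0 : ℝ)..t, grp (-τ) (f τ)) (grp (-t) (f t)) t := by
  have hc : Continuous fun τ => grp (-τ) (f τ) := continuous_grp continuous_neg hf
  exact (intervalIntegral.integral_hasDerivAt_right (hc.intervalIntegrable _ _)
    (hc.stronglyMeasurableAtFilter _ _) hc.continuousAt).const_add x₀

theorem continuous_mild (x₀ : Sob) {f : ℝ → Sob} (hf : Continuous f) : Continuous (mild x₀ f) :=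
  continuous_grp continuous_id <| continuous_iff_continuousAt.2 fun t =>
    (hasDerivAt_interaction x₀ hf t).continuousAt

@[simp] theorem mild_zero (x₀ : Sob) (f : ℝ → Sob) : mild x₀ f 0 = x₀ := by simp [mild]

theorem hasDerivAt_coeffL_mild (x₀ : Sob) {f : ℝ → Sob} (hf : Continuous f) (k : ℤ) (t : ℝ) :
    HasDerivAt (fun t => coeffL k (fn (mild x₀ f t)))
      (-Complex.I * (k : ℂ) ^ 2 * coeffL k (fn (mild x₀ f t)) + coeffL k (fn (f t))) t := by
  have h1 : HasDerivAt (fun t : ℝ => Complex.exp (-Complex.I * (k : ℂ) ^ 2 * (t : ℂ)))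
      (Complex.exp (-Complex.I * (k : ℂ) ^ 2 * (t : ℂ)) * (-Complex.I * (k : ℂ) ^ 2 * 1)) t :=
    (((hasDerivAt_id t).ofReal_comp).const_mul _).cexp
  have h2 := (((coeffL k).comp fn).restrictScalars ℝ).hasFDerivAt.comp_hasDerivAt t
    (hasDerivAt_interaction x₀ hf t)
  have h3 := h1.mul h2
  have e : (fun t => coeffL k (fn (mild x₀ f t))) = fun t : ℝ =>
      Complex.exp (-Complex.I * (k : ℂ) ^ 2 * (t : ℂ)) *
        coeffL k (fn (x₀ + ∫ τ in (0 : ℝ)..t, grp (-τ) (f τ))) := by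
    funext t; rw [mild, coeffL_grp]
  rw [e]
  refine h3.congr_deriv ?_
  rw [mild, coeffL_grp]
  have h4 : coeffL k (fn (f t)) = Complex.exp (-Complex.I * (k : ℂ) ^ 2 * (t : ℂ)) *
      coeffL k (fn (grp (-t) (f t))) := by
    rw [← coeffL_grp, grp_grp_neg]
  rw [h4]
  simp only [ContinuousLinearMap.coe_restrictScalars', ContinuousLinearMap.comp_apply,
    Function.comp_apply]
  ring

theorem norm_indicator_le (s : Finset ℤ) (k : ℤ) : ‖(if k ∈ s then 1 else 0 : ℂ)‖ ≤ 1 := by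
  split_ifs <;> simp

/-- The projection to the frequencies in a finite set. -/
def proj (s : Finset ℤ) : Sob →L[ℂ] Sob := sobMultiplier _ (norm_indicator_le s)

theorem proj_eq_sum (s : Finset ℤ) (u : Sob) :
    proj s u = ∑ k ∈ s, coeffL k (fn u) • expo k := by
  refine fn_injective (ext_coeffL fun l => ?_)
  rw [proj, fn_sobMultiplier, coeffL_multiplier, map_sum, map_sum]
  simp only [map_smul, fn_expo, coeffL_fourierBasis, smul_eq_mul, mul_ite, mul_one, mul_zero]
  rw [Finset.sum_ite_eq s l]
  simp

theorem norm_proj_le (s : Finset ℤ) (u : Sob) : ‖proj s u‖ ≤ ‖u‖ := norm_sobMultiplier_le _ _ _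

/-- The interval of frequencies `|k| ≤ N`. -/
abbrev lowFreq (N : ℕ) : Finset ℤ := Finset.Icc (-(N : ℤ)) N

theorem tendsto_proj (u : Sob) : Tendsto (fun N => proj (lowFreq N) u) atTop (𝓝 u) := by
  have h := tendsto_sobMultiplier (l := atTop) (m₀ := fun _ => 1)
    (fun N : ℕ => norm_indicator_le (lowFreq N)) (fun k => by simp) (fun k => ?_) u
  · have e : sobMultiplier (fun _ => (1 : ℂ)) (fun k => by simp) u = u :=
      fn_injective (ext_coeffL fun k => by
        rw [fn_sobMultiplier, coeffL_multiplier, one_mul])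
    rwa [e] at h
  · refine tendsto_const_nhds.congr' ?_
    filter_upwards [eventually_ge_atTop k.natAbs] with N hN
    rw [if_pos]
    rw [Finset.mem_Icc]
    omega

/-- `G` is the derivative of `Φ` along regular solutions of `u_t = i u_xx + f`. Here `z = u_x` and
`y = u_xx` are required to lie in `H¹`. -/
def IsDerivAlong (Φ : Sob → ℝ) (G : Sob → Sob → ℝ) : Prop :=
  ∀ (w : ℝ → Sob) (t : ℝ) (z y f : Sob), HasDerivAt w (Complex.I • y + f) t →
    fn z = dx (w t) → fn y = dx z → HasDerivAt (fun τ => Φ (w τ)) (G (w t) f) t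

/-- A formula for the derivative of a functional along regular solutions extends by frequency
truncation to all mild solutions. -/
theorem IsDerivAlong.hasDerivAt_mild {Φ : Sob → ℝ} {G : Sob → Sob → ℝ} (h : IsDerivAlong Φ G)
    (hΦ : Continuous Φ) (hlip : LipOnBalls fun q : Sob × Sob => G q.1 q.2)
    (x₀ : Sob) {f : ℝ → Sob} (hf : Continuous f) (t : ℝ) :
    HasDerivAt (fun τ => Φ (mild x₀ f τ)) (G (mild x₀ f t) (f t)) t := by
  set u := mild x₀ f with hu
  have huc : Continuous u := continuous_mild x₀ hf
  have hG := hlip.continuous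
  have hGc : Continuous fun τ => G (u τ) (f τ) := hG.comp (huc.prodMk hf)
  have hd : ∀ s t, HasDerivAt (fun τ => Φ (proj s (u τ))) (G (proj s (u t)) (proj s (f t))) t := by
    intro s t
    refine h (fun τ => proj s (u τ)) t (∑ k ∈ s, (Complex.I * k * coeffL k (fn (u t))) • expo k)
      (∑ k ∈ s, (-(k : ℂ) ^ 2 * coeffL k (fn (u t))) • expo k) (proj s (f t)) ?_ ?_ ?_
    · have e : (fun τ => proj s (u τ)) = fun τ => ∑ k ∈ s, coeffL k (fn (u τ)) • expo k :=
        funext fun τ => proj_eq_sum s _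
      rw [e, proj_eq_sum, Finset.smul_sum, ← Finset.sum_add_distrib]
      refine HasDerivAt.fun_sum fun k _ => ?_
      refine ((hasDerivAt_coeffL_mild x₀ hf k t).smul_const (expo k)).congr_deriv ?_
      rw [add_smul, smul_smul]
      congr 2
      ring
    · rw [proj_eq_sum, map_sum, map_sum]
      refine Finset.sum_congr rfl fun k _ => ?_
      rw [map_smul, map_smul, fn_expo, dx_expo, smul_smul]
      congr 1
      ring
    · rw [map_sum, map_sum]
      refine Finset.sum_congr rfl fun k _ => ?_
      rw [map_smul, map_smul, fn_expo, dx_expo, smul_smul]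
      congr 1
      linear_combination (-((k : ℂ) ^ 2 * coeffL k (fn (u t)))) * Complex.I_mul_I
  have hint : ∀ t, Φ (u t) - Φ (u 0) = ∫ τ in (0 : ℝ)..t, G (u τ) (f τ) := by
    intro t
    have hs : ∀ s, Φ (proj s (u t)) - Φ (proj s (u 0))
        = ∫ τ in (0 : ℝ)..t, G (proj s (u τ)) (proj s (f τ)) := fun s => by
      have hc : Continuous fun τ => G (proj s (u τ)) (proj s (f τ)) :=
        hG.comp (((proj s).continuous.comp huc).prodMk ((proj s).continuous.comp hf))
      exact (intervalIntegral.integral_eq_sub_of_hasDerivAt (fun x _ => hd s x)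
        (hc.intervalIntegrable _ _)).symm
    have hl : Tendsto (fun N => Φ (proj (lowFreq N) (u t)) - Φ (proj (lowFreq N) (u 0))) atTop
        (𝓝 (Φ (u t) - Φ (u 0))) :=
      ((hΦ.tendsto _).comp (tendsto_proj _)).sub ((hΦ.tendsto _).comp (tendsto_proj _))
    refine tendsto_nhds_unique hl ?_
    simp only [hs]
    obtain ⟨R₁, hR₁⟩ := (isCompact_uIcc (a := (0 : ℝ)) (b := t)).exists_bound_of_continuousOn
      huc.continuousOn
    obtain ⟨R₂, hR₂⟩ := (isCompact_uIcc (a := (0 : ℝ)) (b := t)).exists_bound_of_continuousOn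
      hf.continuousOn
    obtain ⟨B, -, hB⟩ := hlip.bounded (max 0 (max R₁ R₂)) (le_max_left _ _)
    refine intervalIntegral.tendsto_integral_filter_of_dominated_convergence (fun _ => B)
      (Eventually.of_forall fun N => ?_) (Eventually.of_forall fun N => ?_) (by simp)
      (Eventually.of_forall fun τ _ => ?_)
    · exact (hG.comp (((proj _).continuous.comp huc).prodMk
        ((proj _).continuous.comp hf))).aestronglyMeasurable
    · refine Eventually.of_forall fun τ hτ => ?_
      have hτ' := Set.uIoc_subset_uIcc hτ
      refine hB (_, _) (max_le ((norm_proj_le _ _).trans ?_) ((norm_proj_le _ _).trans ?_))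
      · exact (hR₁ τ hτ').trans ((le_max_left _ _).trans (le_max_right _ _))
      · exact (hR₂ τ hτ').trans ((le_max_right _ _).trans (le_max_right _ _))
    · exact (hG.tendsto (u τ, f τ)).comp ((tendsto_proj (u τ)).prodMk_nhds (tendsto_proj (f τ)))
  have e : (fun τ => Φ (u τ)) = fun τ => Φ (u 0) + ∫ σ in (0 : ℝ)..τ, G (u σ) (f σ) := by
    funext τ; rw [← hint]; ring
  rw [e]
  exact (intervalIntegral.integral_hasDerivAt_right (hGc.intervalIntegrable _ _)
    (hGc.stronglyMeasurableAtFilter _ _) hGc.continuousAt).const_add _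

/-! ### Derivatives of the conserved quantities and of the virial functional -/

theorem mulS_comm (u v : Sob) : mulS u v = mulS v u :=
  cont_injective (by rw [cont_mulS, cont_mulS, mul_comm (cont u)])

theorem re_inner_I_smul (f g : L2) : (⟪f, Complex.I • g⟫_ℂ).re = -(⟪f, g⟫_ℂ).im := by
  rw [inner_smul_right, Complex.I_mul_re]

theorem im_inner_I_smul (f g : L2) : (⟪f, Complex.I • g⟫_ℂ).im = (⟪f, g⟫_ℂ).re := by
  rw [inner_smul_right, Complex.I_mul_im]

theorem re_inner_comm (f g : L2) : (⟪f, g⟫_ℂ).re = (⟪g, f⟫_ℂ).re := by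
  rw [← inner_conj_symm, Complex.conj_re]

theorem im_inner_comm (f g : L2) : (⟪f, g⟫_ℂ).im = -(⟪g, f⟫_ℂ).im := by
  rw [← inner_conj_symm, Complex.conj_im]

theorem norm_sq_eq_re_inner (f : L2) : ‖f‖ ^ 2 = (⟪f, f⟫_ℂ).re := by
  rw [inner_self_eq_norm_sq_to_K]; norm_cast

theorem im_inner_self (f : L2) : (⟪f, f⟫_ℂ).im = 0 := by
  rw [inner_self_eq_norm_sq_to_K]; norm_cast

theorem hasDerivAt_clm {E : Type*} [NormedAddCommGroup E] [NormedSpace ℂ E] (A : Sob →L[ℂ] E)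
    {w : ℝ → Sob} {w' : Sob} {t : ℝ} (h : HasDerivAt w w' t) :
    HasDerivAt (fun τ => A (w τ)) (A w') t :=
  (A.restrictScalars ℝ).hasFDerivAt.comp_hasDerivAt t h

theorem hasDerivAt_inner {f g : ℝ → L2} {f' g' : L2} {t : ℝ} (hf : HasDerivAt f f' t)
    (hg : HasDerivAt g g' t) :
    HasDerivAt (fun τ => ⟪f τ, g τ⟫_ℂ) (⟪f t, g'⟫_ℂ + ⟪f', g t⟫_ℂ) t := hf.inner ℂ hg

theorem hasDerivAt_re {f : ℝ → ℂ} {f' : ℂ} {t : ℝ} (h : HasDerivAt f f' t) :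
    HasDerivAt (fun τ => (f τ).re) f'.re t := Complex.reCLM.hasFDerivAt.comp_hasDerivAt t h

theorem hasDerivAt_im {f : ℝ → ℂ} {f' : ℂ} {t : ℝ} (h : HasDerivAt f f' t) :
    HasDerivAt (fun τ => (f τ).im) f'.im t := Complex.imCLM.hasFDerivAt.comp_hasDerivAt t h

theorem isDerivAlong_mass :
    IsDerivAlong (fun u => ‖fn u‖ ^ 2) fun u f => 2 * (⟪fn u, fn f⟫_ℂ).re := by
  intro w t z y f hw hz hy
  simp only [norm_sq_eq_re_inner]
  have h := hasDerivAt_clm fn hw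
  refine (hasDerivAt_re (hasDerivAt_inner h h)).congr_deriv ?_
  rw [Complex.add_re, re_inner_comm _ (fn (w t)), map_add, map_smul, inner_add_right,
    Complex.add_re, re_inner_I_smul, hy]
  have e : ⟪fn (w t), dx z⟫_ℂ = -⟪dx (w t), dx (w t)⟫_ℂ := by
    rw [← hz, ← neg_eq_iff_eq_neg, ← inner_dx_left, hz]
  rw [e, Complex.neg_im, im_inner_self]
  ring

theorem isDerivAlong_kinetic :
    IsDerivAlong (fun u => ‖dx u‖ ^ 2) fun u f => 2 * (⟪dx u, dx f⟫_ℂ).re := by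
  intro w t z y f hw hz hy
  simp only [norm_sq_eq_re_inner]
  have h := hasDerivAt_clm dx hw
  refine (hasDerivAt_re (hasDerivAt_inner h h)).congr_deriv ?_
  rw [Complex.add_re, re_inner_comm _ (dx (w t)), map_add, map_smul, inner_add_right,
    Complex.add_re, re_inner_I_smul]
  have e : ⟪dx (w t), dx y⟫_ℂ = -⟪dx z, dx z⟫_ℂ := by
    rw [← hz, ← neg_eq_iff_eq_neg, ← inner_dx_left, hy]
  rw [e, Complex.neg_im, im_inner_self]
  ring

theorem inner_one_mul (g h : C(Torus, ℂ)) :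
    ⟪toL2 1, toL2 (g * h)⟫_ℂ = ⟪toL2 (star g), toL2 h⟫_ℂ := by
  rw [inner_toL2, inner_toL2]
  simp [ContinuousMap.star_apply]

/-- The integral `∫ |u|^(2n)`. -/
def powInt (n : ℕ) (u : Sob) : ℝ := (⟪toL2 1, toL2 ((cont u * star (cont u)) ^ n)⟫_ℂ).re

theorem hasDerivAt_powInt (m : ℕ) {w : ℝ → Sob} {w' : Sob} {t : ℝ} (hw : HasDerivAt w w' t) :
    HasDerivAt (fun τ => powInt (m + 1) (w τ))
      (2 * ((m : ℝ) + 1) * (⟪fn (nonlin m (w t)), fn w'⟫_ℂ).re) t := by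
  have h1 := hasDerivAt_clm cont hw
  have h2 := (h1.mul h1.star).pow (m + 1)
  have h3 := (toL2.restrictScalars ℝ).hasFDerivAt.comp_hasDerivAt t h2
  have h4 := hasDerivAt_re (hasDerivAt_inner (hasDerivAt_const t (toL2 1)) h3)
  refine h4.congr_deriv ?_
  set U := cont (w t)
  set V := cont w'
  set q := U * star U with hq
  have hqs : star (q ^ m) = q ^ m := by rw [star_pow, hq, star_mul, star_star]
  have e1 : ((m + 1 : ℕ) : C(Torus, ℂ)) * q ^ (m + 1 - 1) * (V * star U + U * star V)
      = ((m : ℝ) + 1) • ((q ^ m * star U) * V) + ((m : ℝ) + 1) • ((q ^ m * U) * star V) := by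
    ext x
    simp [ContinuousMap.star_apply]
    ring
  have e2 : ⟪toL2 1, toL2 ((q ^ m * star U) * V)⟫_ℂ = ⟪fn (nonlin m (w t)), fn w'⟫_ℂ := by
    rw [inner_one_mul, star_mul, hqs, star_star, ← toL2_cont (nonlin m (w t)), cont_nonlin,
      ← toL2_cont w']
  have e3 : ⟪toL2 1, toL2 ((q ^ m * U) * star V)⟫_ℂ = ⟪fn w', fn (nonlin m (w t))⟫_ℂ := by
    rw [mul_comm _ (star V), inner_one_mul, star_star, ← toL2_cont (nonlin m (w t)), cont_nonlin,
      ← toL2_cont w', mul_comm (q ^ m)]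
  rw [inner_zero_left, add_zero]
  change (⟪toL2 1, toL2 (((m + 1 : ℕ) : C(Torus, ℂ)) * q ^ (m + 1 - 1)
    * (V * star U + U * star V))⟫_ℂ).re = _
  rw [e1, map_add, inner_add_right, ← Complex.coe_smul, ← Complex.coe_smul, map_smul, map_smul,
    inner_smul_right, inner_smul_right, e2, e3,
    Complex.add_re, Complex.re_ofReal_mul, Complex.re_ofReal_mul, re_inner_comm (fn w')]
  ring

theorem isDerivAlong_potential (m : ℕ) :
    IsDerivAlong (powInt (m + 1)) fun u f => 2 * ((m : ℝ) + 1) *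
      ((⟪dx (nonlin m u), dx u⟫_ℂ).im + (⟪fn (nonlin m u), fn f⟫_ℂ).re) := by
  intro w t z y f hw hz hy
  refine (hasDerivAt_powInt m hw).congr_deriv ?_
  rw [map_add, map_smul, inner_add_right, Complex.add_re, re_inner_I_smul, hy,
    ← neg_eq_iff_eq_neg.2 (inner_dx_left (nonlin m (w t)) z), hz, Complex.neg_im, neg_neg]

/-- The virial functional `Im ∫ φ ū u_x`. -/
def virial (φ u : Sob) : ℝ := (⟪fn u, cmul (cont φ) (dx u)⟫_ℂ).im

/-- The identity of Morawetz type: for a real multiplier `φ` with derivative `ψ ∈ H¹`, the virial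
functional grows like `2 ∫ ψ |u_x|²`, up to lower-order terms. -/
theorem isDerivAlong_virial {φ ψ : Sob} (hφ : star (cont φ) = cont φ)
    (hd : dx φ = fn ψ) :
    IsDerivAlong (virial φ) fun u f =>
      2 * (⟪dx u, cmul (cont ψ) (dx u)⟫_ℂ).re + (⟪cmul (cont u) (dx ψ), dx u⟫_ℂ).re
        - (2 * (⟪cmul (cont φ) (dx u), fn f⟫_ℂ).im + (⟪cmul (cont ψ) (fn u), fn f⟫_ℂ).im) := by
  intro w t z y f hw hz hy
  have h1 := hasDerivAt_clm fn hw
  have h2 := hasDerivAt_clm ((cmul (cont φ)).comp dx) hw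
  refine (hasDerivAt_im (hasDerivAt_inner h1 h2)).congr_deriv ?_
  set u := w t
  set w' := Complex.I • y + f with hw'
  have hψu : cmul (cont u) (fn ψ) = cmul (cont ψ) (fn u) := by
    rw [← fn_mulS, ← fn_mulS, mulS_comm]
  have e1 : ⟪fn u, cmul (cont φ) (dx w')⟫_ℂ
      = -(⟪cmul (cont φ) (dx u), fn w'⟫_ℂ + ⟪cmul (cont ψ) (fn u), fn w'⟫_ℂ) := by
    rw [inner_cmul_right, hφ, ← fn_mulS, ← inner_add_left, ← hψu, ← hd, ← dx_mulS, inner_dx_left,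
      neg_neg]
  have e2 : (⟪fn w', cmul (cont φ) (dx u)⟫_ℂ).im = -(⟪cmul (cont φ) (dx u), fn w'⟫_ℂ).im :=
    im_inner_comm _ _
  have e3 : fn w' = Complex.I • dx z + fn f := by rw [hw', map_add, map_smul, hy]
  -- `2 Re ∫ φ z̄ z_x = -∫ ψ |z|²`
  have e4 : 2 * (⟪cmul (cont φ) (dx u), dx z⟫_ℂ).re = -(⟪dx u, cmul (cont ψ) (dx u)⟫_ℂ).re := by
    have h := inner_dx_left (mulS φ z) z
    have hψz : cmul (cont z) (fn ψ) = cmul (cont ψ) (fn z) := by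
      rw [← fn_mulS, ← fn_mulS, mulS_comm]
    rw [dx_mulS, hd, hψz, fn_mulS, inner_add_left, hz] at h
    have h' := congrArg Complex.re h
    rw [Complex.add_re, Complex.neg_re, inner_cmul_left, hφ, re_inner_comm,
      re_inner_comm (cmul (cont ψ) (dx u))] at h'
    linarith
  have e5 : (⟪cmul (cont ψ) (fn u), dx z⟫_ℂ).re
      = -((⟪dx u, cmul (cont ψ) (dx u)⟫_ℂ).re + (⟪cmul (cont u) (dx ψ), dx u⟫_ℂ).re) := by
    have h := inner_dx_left (mulS ψ u) z
    rw [dx_mulS, fn_mulS, inner_add_left, hz] at h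
    have h' := congrArg Complex.re h
    rw [Complex.add_re, Complex.neg_re, re_inner_comm (cmul (cont ψ) (dx u))] at h'
    linarith
  change (⟪fn u, cmul (cont φ) (dx w')⟫_ℂ + ⟪fn w', cmul (cont φ) (dx u)⟫_ℂ).im = _
  rw [Complex.add_im, e1, e2, e3]
  simp only [inner_add_right, Complex.neg_im, Complex.add_im, im_inner_I_smul]
  linarith

/-! ### The damping coefficient -/

/-- The derivative of a smooth function on the circle. -/
theorem exists_circle_deriv {g : C(Torus, ℝ)} (hg : ContDiff ℝ ∞ fun x : ℝ => g (x : Torus)) :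
    ∃ g' : C(Torus, ℝ), (ContDiff ℝ ∞ fun x : ℝ => g' (x : Torus)) ∧
      ∀ x : ℝ, HasDerivAt (fun x : ℝ => g (x : Torus)) (g' (x : Torus)) x := by
  set G : ℝ → ℝ := fun x => g (x : Torus) with hG
  have hs : ContDiff ℝ ∞ (deriv G) := (contDiff_infty_iff_deriv.1 hg).2
  have hper : Function.Periodic (deriv G) (2 * π) := fun x => by
    have h : (fun y => G (y + 2 * π)) = G := by
      funext y; simp only [hG, AddCircle.coe_add_period]
    rw [← deriv_comp_add_const, h]
  have hc : Continuous (hper.lift : Torus → ℝ) := by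
    refine (isQuotientMap_quotient_mk'.continuous_iff).2 ?_
    exact hs.continuous
  refine ⟨⟨hper.lift, hc⟩, hs, fun x => ?_⟩
  exact ((contDiff_infty_iff_deriv.1 hg).1 x).hasDerivAt

/-- A non-negative smooth function `g` satisfies `|g'|² ≤ D g`. -/
theorem exists_sq_deriv_le {g g' : C(Torus, ℝ)} (hpos : ∀ x, 0 ≤ g x)
    (h : ∀ x : ℝ, HasDerivAt (fun x : ℝ => g (x : Torus)) (g' (x : Torus)) x)
    (hg' : ContDiff ℝ ∞ fun x : ℝ => g' (x : Torus)) :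
    ∃ D : ℝ, 0 ≤ D ∧ ∀ x, g' x ^ 2 ≤ D * g x := by
  obtain ⟨g'', -, h2⟩ := exists_circle_deriv hg'
  set M := ‖g''‖ with hM
  have hlip : ∀ x y : ℝ, |g' (y : Torus) - g' (x : Torus)| ≤ M * |y - x| := fun x y => by
    have := (convex_univ (𝕜 := ℝ) (E := ℝ)).norm_image_sub_le_of_norm_hasDerivWithin_le
      (f := fun x : ℝ => g' (x : Torus)) (f' := fun x : ℝ => g'' (x : Torus)) (C := M)
      (fun x _ => (h2 x).hasDerivWithinAt) (fun x _ => g''.norm_coe_le_norm _)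
      (Set.mem_univ x) (Set.mem_univ y)
    simpa using this
  refine ⟨4 * M, by positivity, fun θ => ?_⟩
  obtain ⟨x, rfl⟩ := QuotientAddGroup.mk_surjective θ
  -- Taylor's inequality bounds the non-negative value `g (x + r)` by a quadratic polynomial in `r`,
  -- whose discriminant is therefore not positive.
  have hq : ∀ r : ℝ, 0 ≤ M * (r * r) + g' (x : Torus) * r + g (x : Torus) := fun r => by
    have hd : ∀ y ∈ Set.uIcc x (x + r), HasDerivWithinAt
        (fun y : ℝ => g (y : Torus) - g' (x : Torus) * y) (g' (y : Torus) - g' (x : Torus))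
        (Set.uIcc x (x + r)) y := fun y _ => by
      have := ((h y).sub ((hasDerivAt_id y).const_mul (g' (x : Torus)))).hasDerivWithinAt
        (s := Set.uIcc x (x + r))
      rwa [mul_one] at this
    have hb : ∀ y ∈ Set.uIcc x (x + r), ‖g' (y : Torus) - g' (x : Torus)‖ ≤ M * |r| :=
        fun y hy => by
      refine (hlip x y).trans ?_
      have := Set.abs_sub_left_of_mem_uIcc hy
      rw [add_sub_cancel_left] at this
      gcongr
    have := (convex_uIcc x (x + r)).norm_image_sub_le_of_norm_hasDerivWithin_le hd hb
      Set.left_mem_uIcc Set.right_mem_uIcc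
    rw [add_sub_cancel_left, Real.norm_eq_abs, Real.norm_eq_abs] at this
    have h3 := (abs_le.1 this).2
    have h4 : M * |r| * |r| = M * (r * r) := by rw [mul_assoc, abs_mul_abs_self]
    have h5 := hpos ((x + r : ℝ) : Torus)
    rw [h4] at h3
    nlinarith
  have := discrim_le_zero hq
  rw [discrim] at this
  linarith

/-- The functions attached to a damping coefficient `a`: its derivative `a'`, and a multiplier
`φ` with `φ' = 1 - c a`, where `c` is the inverse of the mean value of `a`. -/
structure VirialData (a : C(Torus, ℝ)) where
  /-- `a` as an element of `H¹` -/
  aS : Sob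
  /-- the derivative of `a` -/
  a' : C(Torus, ℝ)
  /-- the multiplier as an element of `H¹` -/
  φS : Sob
  /-- the multiplier -/
  φ : C(Torus, ℝ)
  /-- the inverse of the mean value of `a` -/
  c : ℝ
  /-- a constant with `|a'|² ≤ D a` -/
  D : ℝ
  cont_aS : cont aS = ofRealC a
  dx_aS : dx aS = toL2 (ofRealC a')
  cont_φS : cont φS = ofRealC φ
  dx_φS : dx φS = toL2 (1 - (c : ℂ) • ofRealC a)
  nonneg : ∀ x, 0 ≤ a x
  c_pos : 0 < c
  mean : c * ∫ x, a x ∂haar = 1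
  D_nonneg : 0 ≤ D
  sq_deriv_le : ∀ x, a' x ^ 2 ≤ D * a x

theorem integral_pos_of_isLocalizedDamping {a : C(Torus, ℝ)} (ha : IsLocalizedDamping a) :
    0 < ∫ x, a x ∂haar := by
  obtain ⟨a₀, ha₀, I, -, ⟨x, hx⟩, hI⟩ := ha.localized
  refine a.continuous.integral_pos_of_hasCompactSupport_nonneg_nonzero (x := x)
    (HasCompactSupport.of_compactSpace _) ha.nonneg ?_
  exact (ha₀.trans_le (hI x hx)).ne'

theorem IsLocalizedDamping.nonempty_virialData {a : C(Torus, ℝ)} (ha : IsLocalizedDamping a) :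
    Nonempty (VirialData a) := by
  obtain ⟨a', ha', hd⟩ := exists_circle_deriv ha.smooth
  obtain ⟨D, hD, hsq⟩ := exists_sq_deriv_le ha.nonneg hd ha'
  obtain ⟨aS, haS, hdaS⟩ := exists_sob_of_hasDerivAt (g := ofRealC a) (g' := ofRealC a')
    fun x => (hd x).ofReal_comp
  have hm := integral_pos_of_isLocalizedDamping ha
  set c := (∫ x, a x ∂haar)⁻¹ with hc
  have hmean : c * ∫ x, a x ∂haar = 1 := inv_mul_cancel₀ hm.ne'
  have h0 : coeffL 0 (toL2 (1 - (c : ℂ) • ofRealC a)) = 0 := by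
    have e : ∫ x, ofRealC a x ∂haar = ((∫ x, a x ∂haar : ℝ) : ℂ) := integral_ofReal
    rw [map_sub, map_smul, map_sub, map_smul, coeffL_toL2, coeffL_toL2, fourierCoeff, fourierCoeff]
    simp only [neg_zero, fourier_zero, one_smul]
    rw [e, smul_eq_mul, ← Complex.ofReal_mul, hmean]
    simp
  obtain ⟨φ₀, hφ₀⟩ := exists_dx_eq h0
  have hreal : star (1 - (c : ℂ) • ofRealC a) = 1 - (c : ℂ) • ofRealC a := by
    rw [star_sub, star_smul, star_ofRealC, star_one]; simp
  -- The antiderivative given by `exists_dx_eq` is replaced by its real part.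
  refine ⟨⟨aS, a', (1 / 2 : ℂ) • (φ₀ + conjS φ₀), ⟨fun x => (cont φ₀ x).re, by fun_prop⟩, c, D,
    haS, hdaS, ?_, ?_, ha.nonneg, inv_pos.2 hm, hmean, hD, hsq⟩⟩
  · rw [map_smul, map_add, cont_conjS]
    ext x
    have := Complex.add_conj (cont φ₀ x)
    push_cast at this
    simp
    linear_combination (1 / 2 : ℂ) * this
  · rw [map_smul, map_add, dx_conjS, hφ₀, conjL2_toL2, hreal, ← two_smul ℂ, smul_smul]
    norm_num

/-! ### Weighted integrals -/

/-- The weighted integral `∫ b |f|²`. -/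
def wInt (b : C(Torus, ℝ)) (f : L2) : ℝ := (⟪f, cmul (ofRealC b) f⟫_ℂ).re

/-- The weighted integral `∫ b |u|^(2n)`. -/
def pInt (b : C(Torus, ℝ)) (n : ℕ) (u : Sob) : ℝ := ∫ x, b x * ‖cont u x‖ ^ (2 * n) ∂haar

theorem ofRealC_mul (a b : C(Torus, ℝ)) : ofRealC (a * b) = ofRealC a * ofRealC b := by
  ext x; simp

theorem ofRealC_one : ofRealC 1 = 1 := by ext x; simp

theorem im_inner_cmul_ofRealC (b : C(Torus, ℝ)) (f : L2) :
    (⟪f, cmul (ofRealC b) f⟫_ℂ).im = 0 := by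
  have h := im_inner_comm f (cmul (ofRealC b) f)
  rw [inner_cmul_left, star_ofRealC] at h
  linarith

/-- The square root of a real function. -/
def sqrtC (b : C(Torus, ℝ)) : C(Torus, ℝ) := ⟨fun x => √(b x), by fun_prop⟩

theorem wInt_eq_sq {b : C(Torus, ℝ)} (hb : ∀ x, 0 ≤ b x) (f : L2) :
    wInt b f = ‖cmul (ofRealC (sqrtC b)) f‖ ^ 2 := by
  have e : ofRealC b = ofRealC (sqrtC b) * ofRealC (sqrtC b) := by
    ext x
    change (b x : ℂ) = (√(b x) : ℂ) * (√(b x) : ℂ)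
    rw [← Complex.ofReal_mul, Real.mul_self_sqrt (hb x)]
  rw [wInt, e, cmul_mul, inner_cmul_right, star_ofRealC, norm_sq_eq_re_inner]

theorem wInt_nonneg {b : C(Torus, ℝ)} (hb : ∀ x, 0 ≤ b x) (f : L2) : 0 ≤ wInt b f := by
  rw [wInt_eq_sq hb]; positivity

theorem wInt_add_le {b : C(Torus, ℝ)} (hb : ∀ x, 0 ≤ b x) (f g : L2) :
    wInt b (f + g) ≤ 2 * wInt b f + 2 * wInt b g := by
  rw [wInt_eq_sq hb, wInt_eq_sq hb, wInt_eq_sq hb, map_add]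
  have := pow_le_pow_left₀ (norm_nonneg _)
    (norm_add_le (cmul (ofRealC (sqrtC b)) f) (cmul (ofRealC (sqrtC b)) g)) 2
  nlinarith [sq_nonneg (‖cmul (ofRealC (sqrtC b)) f‖ - ‖cmul (ofRealC (sqrtC b)) g‖)]

theorem wInt_mono {b b' : C(Torus, ℝ)} (h : ∀ x, b x ≤ b' x) (f : L2) : wInt b f ≤ wInt b' f := by
  have h1 := wInt_nonneg (b := b' - b) (fun x => by simpa using h x) f
  have e : ofRealC (b' - b) = ofRealC b' - ofRealC b := by ext x; simp
  rw [wInt, e, map_sub, sub_apply, inner_sub_right, Complex.sub_re] at h1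
  exact sub_nonneg.1 h1

theorem wInt_const_smul (r : ℝ) (b : C(Torus, ℝ)) (f : L2) : wInt (r • b) f = r * wInt b f := by
  have e : ofRealC (r • b) = (r : ℂ) • ofRealC b := by ext x; simp
  rw [wInt, e, map_smul, smul_apply, inner_smul_right, Complex.re_ofReal_mul, wInt]

theorem wInt_le_norm (b : C(Torus, ℝ)) (f : L2) : wInt b f ≤ ‖b‖ * ‖f‖ ^ 2 := by
  have h := wInt_mono (b := b) (b' := ‖b‖ • (1 : C(Torus, ℝ)))
    (fun x => by simpa using (le_abs_self _).trans (b.norm_coe_le_norm x)) f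
  have h1 : wInt 1 f = ‖f‖ ^ 2 := by rw [wInt, ofRealC_one, cmul_one, ← norm_sq_eq_re_inner]
  rwa [wInt_const_smul, h1] at h

/-- If `b² ≤ K a` pointwise, then `∫ |b f|² ≤ K ∫ a |f|²`. -/
theorem norm_cmul_sq_le {a b : C(Torus, ℝ)} {K : ℝ} (h : ∀ x, b x ^ 2 ≤ K * a x) (f : L2) :
    ‖cmul (ofRealC b) f‖ ^ 2 ≤ K * wInt a f := by
  have h1 : ‖cmul (ofRealC b) f‖ ^ 2 = wInt (b * b) f := by
    rw [wInt, ofRealC_mul, cmul_mul, inner_cmul_right, star_ofRealC, norm_sq_eq_re_inner]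
  rw [h1, ← wInt_const_smul]
  refine wInt_mono (fun x => ?_) f
  simpa [sq] using h x

theorem integrable_of_continuous {g : Torus → ℝ} (hg : Continuous g) : Integrable g haar :=
  hg.integrable_of_hasCompactSupport (HasCompactSupport.of_compactSpace _)

theorem pInt_nonneg {b : C(Torus, ℝ)} (hb : ∀ x, 0 ≤ b x) (n : ℕ) (u : Sob) : 0 ≤ pInt b n u :=
  integral_nonneg fun x => mul_nonneg (hb x) (by positivity)

theorem inner_one_ofRealC_mul_pow (b : C(Torus, ℝ)) (n : ℕ) (u : Sob) :
    ⟪toL2 1, toL2 (ofRealC b * (cont u * star (cont u)) ^ n)⟫_ℂ = (pInt b n u : ℂ) := by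
  rw [inner_toL2, pInt, ← integral_complex_ofReal]
  refine integral_congr_ae (Eventually.of_forall fun x => ?_)
  simp [ContinuousMap.star_apply, Complex.mul_conj', pow_mul]

theorem powInt_eq (n : ℕ) (u : Sob) : powInt n u = pInt 1 n u := by
  have h := inner_one_ofRealC_mul_pow 1 n u
  rw [ofRealC_one, one_mul] at h
  rw [powInt, h, Complex.ofReal_re]

theorem inner_fn_cmul_nonlin (b : C(Torus, ℝ)) (m : ℕ) (u : Sob) :
    ⟪fn u, cmul (ofRealC b) (fn (nonlin m u))⟫_ℂ = (pInt b (m + 1) u : ℂ) := by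
  rw [← inner_one_ofRealC_mul_pow, ← toL2_cont (nonlin m u), cont_nonlin, cmul_toL2, ← toL2_cont u]
  have e : ofRealC b * (cont u * star (cont u)) ^ (m + 1)
      = star (cont u) * (ofRealC b * (cont u * (cont u * star (cont u)) ^ m)) := by ring
  rw [e, inner_one_mul, star_star]

theorem inner_fn_nonlin (m : ℕ) (u : Sob) :
    ⟪fn u, fn (nonlin m u)⟫_ℂ = (powInt (m + 1) u : ℂ) := by
  rw [powInt_eq, ← inner_fn_cmul_nonlin, ofRealC_one, cmul_one]

theorem powInt_nonneg (n : ℕ) (u : Sob) : 0 ≤ powInt n u := by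
  rw [powInt_eq]; exact pInt_nonneg (fun _ => by simp) n u

/-- `2 Re ∫ φ |u|^(2m) u ū_x = -(m + 1)⁻¹ ∫ ψ |u|^(2m+2)` for a real function `φ ∈ H¹` with
derivative `ψ`. -/
theorem re_inner_cmul_nonlin {φS : Sob} {φ ψ : C(Torus, ℝ)} (hφ : cont φS = ofRealC φ)
    (hψ : dx φS = toL2 (ofRealC ψ)) (m : ℕ) (u : Sob) :
    2 * ((m : ℝ) + 1) * (⟪cmul (cont φS) (dx u), fn (nonlin m u)⟫_ℂ).re = -pInt ψ (m + 1) u := by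
  set q := cont u * star (cont u) with hq
  have h := inner_dx_left φS (powS (sqS u) (m + 1))
  have hqs : star (q ^ m) = q ^ m := by rw [star_pow, hq, star_mul, star_star]
  have e1 : ⟪dx φS, fn (powS (sqS u) (m + 1))⟫_ℂ = (pInt ψ (m + 1) u : ℂ) := by
    rw [hψ, ← inner_one_ofRealC_mul_pow, inner_one_mul, star_ofRealC, ← toL2_cont, cont_powS,
      cont_sqS]
  have e2 : ⟪fn φS, dx (powS (sqS u) (m + 1))⟫_ℂ = ((m : ℂ) + 1) *
      (⟪cmul (cont φS) (dx u), fn (nonlin m u)⟫_ℂ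
        + conj ⟪cmul (cont φS) (dx u), fn (nonlin m u)⟫_ℂ) := by
    have hN : cmul (cont φS) (fn (nonlin m u)) = cmul (q ^ m * cont u) (fn φS) := by
      rw [← toL2_cont (nonlin m u), cont_nonlin, cmul_toL2, ← toL2_cont φS, cmul_toL2, ← hq]
      congr 1; ring
    have hs : star (cont φS) = cont φS := by rw [hφ, star_ofRealC]
    have hr : conjL2 (fn φS) = fn φS := by rw [← toL2_cont, conjL2_toL2, hs]
    have hI : ⟪cmul (cont φS) (dx u), fn (nonlin m u)⟫_ℂ
        = ⟪dx u, cmul (q ^ m * cont u) (fn φS)⟫_ℂ := by rw [inner_cmul_left, hs, hN]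
    rw [dx_powS_succ, inner_smul_right, cont_sqS, ← hq, sqS, dx_mulS, dx_conjS, cont_conjS, map_add,
      inner_add_right, ← cmul_mul, ← cmul_mul]
    congr 2
    · have e3 : cmul (q ^ m * cont u) (conjL2 (dx u))
          = conjL2 (cmul (q ^ m * star (cont u)) (dx u)) := by
        rw [← cmul_conjL2, star_mul, star_star, hqs, mul_comm (cont u)]
      rw [e3, hI, ← inner_conj_symm, inner_conjL2, hr, inner_conj_symm, inner_cmul_right, star_mul,
        hqs, mul_comm (star (cont u))]
    · rw [hI, inner_conj_symm, inner_cmul_right, star_mul, hqs, star_star, mul_comm (cont u)]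
  rw [e1, e2, Complex.add_conj] at h
  have h' := congrArg Complex.re h
  have e4 : ((m : ℂ) + 1) = (((m : ℝ) + 1 : ℝ) : ℂ) := by push_cast; ring
  rw [e4, ← Complex.ofReal_mul, ← Complex.ofReal_neg, Complex.ofReal_re, Complex.ofReal_re] at h'
  linarith

/-! ### The balance laws of the damped equation -/

section Balance

variable {a : C(Torus, ℝ)} (d : VirialData a) (m : ℕ) (u : Sob)

/-- The commutator term `Re ∫ a' u ū_x`. -/
def VirialData.commutator : ℝ := (⟪dx u, cmul (ofRealC d.a') (fn u)⟫_ℂ).re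

/-- The mixed term `Im ∫ φ a u ū_x`. -/
def VirialData.mixed : ℝ := (⟪dx u, cmul (ofRealC (d.φ * a)) (fn u)⟫_ℂ).im

/-- The derivative `1 - c a` of the multiplier, as an element of `H¹`. -/
def VirialData.ψS : Sob := oneS - (d.c : ℂ) • d.aS

theorem VirialData.cont_ψS : cont d.ψS = ofRealC (1 - d.c • a) := by
  rw [VirialData.ψS, map_sub, cont_oneS, map_smul, d.cont_aS]; ext x; simp

theorem VirialData.dx_φS_eq : dx d.φS = toL2 (ofRealC (1 - d.c • a)) := by
  rw [d.dx_φS]; congr 1; ext x; simp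

theorem VirialData.cmul_cont_dx_aS :
    cmul (cont u) (dx d.aS) = cmul (ofRealC d.a') (fn u) := by
  rw [d.dx_aS, cmul_toL2, ← toL2_cont u, cmul_toL2, mul_comm (cont u)]

theorem VirialData.fn_field :
    fn (field d.aS m u) = -cmul (ofRealC a) (fn u) - Complex.I • fn (nonlin m u) := by
  rw [field, map_sub, map_neg, map_smul, fn_mulS, d.cont_aS]

theorem VirialData.dx_field :
    dx (field d.aS m u) = -(cmul (ofRealC a) (dx u) + cmul (ofRealC d.a') (fn u))
      - Complex.I • dx (nonlin m u) := by
  rw [field, map_sub, map_neg, map_smul, dx_mulS, d.cont_aS, d.cmul_cont_dx_aS]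

theorem VirialData.mass_balance :
    (⟪fn u, fn (field d.aS m u)⟫_ℂ).re = -wInt a (fn u) := by
  rw [d.fn_field, inner_sub_right, inner_neg_right, Complex.sub_re, Complex.neg_re,
    re_inner_I_smul, inner_fn_nonlin, Complex.ofReal_im, wInt]
  ring

theorem VirialData.energy_balance :
    (⟪dx u, dx (field d.aS m u)⟫_ℂ).re + ((⟪dx (nonlin m u), dx u⟫_ℂ).im
        + (⟪fn (nonlin m u), fn (field d.aS m u)⟫_ℂ).re)
      = -wInt a (dx u) - pInt a (m + 1) u - d.commutator u := by
  have h1 : (⟪fn (nonlin m u), cmul (ofRealC a) (fn u)⟫_ℂ).re = pInt a (m + 1) u := by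
    rw [inner_cmul_right, star_ofRealC, re_inner_comm, inner_fn_cmul_nonlin, Complex.ofReal_re]
  rw [d.fn_field, d.dx_field, inner_sub_right, inner_sub_right, inner_neg_right, inner_neg_right,
    inner_add_right, Complex.sub_re, Complex.sub_re, Complex.neg_re, Complex.neg_re, Complex.add_re,
    re_inner_I_smul, re_inner_I_smul, im_inner_self, h1, im_inner_comm (dx (nonlin m u)),
    VirialData.commutator, wInt]
  ring

theorem VirialData.wInt_ψ (f : L2) : wInt (1 - d.c • a) f = ‖f‖ ^ 2 - d.c * wInt a f := by
  have e : ofRealC (1 - d.c • a) = 1 - (d.c : ℂ) • ofRealC a := by ext x; simp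
  rw [wInt, e, map_sub, map_smul, sub_apply, smul_apply, cmul_one, inner_sub_right,
    inner_smul_right, Complex.sub_re, Complex.re_ofReal_mul, ← norm_sq_eq_re_inner, wInt]

theorem VirialData.pInt_ψ (n : ℕ) : pInt (1 - d.c • a) n u = powInt n u - d.c * pInt a n u := by
  rw [powInt_eq, pInt, pInt, pInt, ← integral_const_mul, ← integral_sub]
  · congr 1; ext x; simp; ring
  · exact integrable_of_continuous (by fun_prop)
  · exact integrable_of_continuous (by fun_prop)

theorem VirialData.virial_balance :
    2 * (⟪dx u, cmul (cont d.ψS) (dx u)⟫_ℂ).re + (⟪cmul (cont u) (dx d.ψS), dx u⟫_ℂ).re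
        - (2 * (⟪cmul (cont d.φS) (dx u), fn (field d.aS m u)⟫_ℂ).im
          + (⟪cmul (cont d.ψS) (fn u), fn (field d.aS m u)⟫_ℂ).im)
      = 2 * (‖dx u‖ ^ 2 - d.c * wInt a (dx u)) - d.c * d.commutator u
        + (1 - ((m : ℝ) + 1)⁻¹) * (powInt (m + 1) u - d.c * pInt a (m + 1) u)
        + 2 * d.mixed u := by
  have h1 : (⟪dx u, cmul (cont d.ψS) (dx u)⟫_ℂ).re = ‖dx u‖ ^ 2 - d.c * wInt a (dx u) := by
    rw [d.cont_ψS, ← d.wInt_ψ]; rfl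
  have h2 : (⟪cmul (cont u) (dx d.ψS), dx u⟫_ℂ).re = -(d.c * d.commutator u) := by
    rw [VirialData.ψS, map_sub, dx_oneS, zero_sub, map_smul, map_neg, map_smul, d.cmul_cont_dx_aS,
      inner_neg_left, inner_smul_left, Complex.conj_ofReal, Complex.neg_re, Complex.re_ofReal_mul,
      re_inner_comm, VirialData.commutator]
  have h3 : (⟪cmul (cont d.φS) (dx u), cmul (ofRealC a) (fn u)⟫_ℂ).im = d.mixed u := by
    rw [d.cont_φS, inner_cmul_left, star_ofRealC, ← cmul_mul, ← ofRealC_mul,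
      VirialData.mixed]
  have h4 := re_inner_cmul_nonlin d.cont_φS d.dx_φS_eq m u
  have h5 : (⟪cmul (cont d.ψS) (fn u), cmul (ofRealC a) (fn u)⟫_ℂ).im = 0 := by
    rw [d.cont_ψS, inner_cmul_left, star_ofRealC, ← cmul_mul, ← ofRealC_mul,
      im_inner_cmul_ofRealC]
  have h6 : (⟪cmul (cont d.ψS) (fn u), fn (nonlin m u)⟫_ℂ).re = pInt (1 - d.c • a) (m + 1) u := by
    rw [d.cont_ψS, inner_cmul_left, star_ofRealC, inner_fn_cmul_nonlin, Complex.ofReal_re]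
  have hm : (0 : ℝ) < (m : ℝ) + 1 := by positivity
  have h4' : 2 * (⟪cmul (cont d.φS) (dx u), fn (nonlin m u)⟫_ℂ).re
      = -(((m : ℝ) + 1)⁻¹ * pInt (1 - d.c • a) (m + 1) u) := by
    field_simp; linarith
  rw [h1, h2, d.fn_field]
  simp only [inner_sub_right, inner_neg_right, Complex.sub_im, Complex.neg_im, im_inner_I_smul]
  rw [h3, h5, h6, ← d.pInt_ψ]
  linarith

end Balance

/-! ### Coercivity estimates -/

section Estimates

variable {a : C(Torus, ℝ)} (d : VirialData a) (u : Sob)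

theorem VirialData.sq_commutator_le :
    d.commutator u ^ 2 ≤ d.D * ‖dx u‖ ^ 2 * wInt a (fn u) := by
  have h1 : |d.commutator u| ≤ ‖dx u‖ * ‖cmul (ofRealC d.a') (fn u)‖ :=
    (Complex.abs_re_le_norm _).trans (norm_inner_le_norm _ _)
  have h2 := norm_cmul_sq_le d.sq_deriv_le (fn u)
  rw [← sq_abs]
  calc _ ≤ (‖dx u‖ * ‖cmul (ofRealC d.a') (fn u)‖) ^ 2 := by gcongr
    _ = ‖dx u‖ ^ 2 * ‖cmul (ofRealC d.a') (fn u)‖ ^ 2 := by ring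
    _ ≤ ‖dx u‖ ^ 2 * (d.D * wInt a (fn u)) := by gcongr
    _ = _ := by ring

theorem VirialData.sq_mixed_le :
    d.mixed u ^ 2 ≤ ‖d.φ‖ ^ 2 * ‖a‖ * ‖dx u‖ ^ 2 * wInt a (fn u) := by
  have h1 : |d.mixed u| ≤ ‖dx u‖ * ‖cmul (ofRealC (d.φ * a)) (fn u)‖ :=
    (Complex.abs_im_le_norm _).trans (norm_inner_le_norm _ _)
  have h2 := norm_cmul_sq_le (a := a) (b := d.φ * a) (K := ‖d.φ‖ ^ 2 * ‖a‖) (fun x => by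
    have h3 : d.φ x ^ 2 ≤ ‖d.φ‖ ^ 2 := by
      rw [← sq_abs]; exact pow_le_pow_left₀ (abs_nonneg _) (d.φ.norm_coe_le_norm x) 2
    have h4 : a x ≤ ‖a‖ := (le_abs_self _).trans (a.norm_coe_le_norm x)
    have h5 := d.nonneg x
    rw [ContinuousMap.mul_apply, mul_pow, sq (a x), mul_assoc]
    gcongr) (fn u)
  rw [← sq_abs]
  calc _ ≤ (‖dx u‖ * ‖cmul (ofRealC (d.φ * a)) (fn u)‖) ^ 2 := by gcongr
    _ = ‖dx u‖ ^ 2 * ‖cmul (ofRealC (d.φ * a)) (fn u)‖ ^ 2 := by ring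
    _ ≤ ‖dx u‖ ^ 2 * (‖d.φ‖ ^ 2 * ‖a‖ * wInt a (fn u)) := by gcongr
    _ = _ := by ring

theorem VirialData.abs_virial_le : |virial d.φS u| ≤ ‖d.φ‖ * ‖fn u‖ * ‖dx u‖ := by
  have h1 : |virial d.φS u| ≤ ‖fn u‖ * ‖cmul (ofRealC d.φ) (dx u)‖ := by
    rw [virial, d.cont_φS]
    exact (Complex.abs_im_le_norm _).trans (norm_inner_le_norm _ _)
  have h2 : ‖cmul (ofRealC d.φ) (dx u)‖ ≤ ‖d.φ‖ * ‖dx u‖ := by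
    refine Lp.norm_le_mul_norm_of_ae_le_mul ?_
    filter_upwards [coeFn_cmul (ofRealC d.φ) (dx u)] with x hx
    rw [hx, norm_mul, ofRealC_apply, Complex.norm_real]
    gcongr
    exact d.φ.norm_coe_le_norm x
  calc _ ≤ ‖fn u‖ * (‖d.φ‖ * ‖dx u‖) := h1.trans (by gcongr)
    _ = _ := by ring

/-- Poincaré inequality: the mean value of `u` is controlled by `∫ a |u|²`. -/
theorem VirialData.poincare :
    ‖fn u‖ ^ 2 ≤ (4 * d.c + 4 * d.c * ‖a‖ + 2) * (‖dx u‖ ^ 2 + wInt a (fn u)) := by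
  have hc := d.c_pos
  set z := coeffL 0 (fn u) with hz
  set v := u - z • oneS with hv
  have hfv : fn v = fn u - z • fn oneS := by rw [hv, map_sub, map_smul]
  have h1 : ‖fn v‖ ^ 2 ≤ ‖dx u‖ ^ 2 := by
    have hd : dx v = dx u := by rw [hv, map_sub, map_smul, dx_oneS, smul_zero, sub_zero]
    rw [← hd]
    refine hasSum_le (fun k => ?_) (hasSum_norm_sq_coeffL _) (hasSum_norm_sq_coeffL _)
    rw [coeffL_dx, norm_mul, norm_mul, Complex.norm_I, one_mul, Complex.norm_intCast]
    rcases eq_or_ne k 0 with rfl | hk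
    · have : coeffL 0 (fn v) = 0 := by
        rw [hfv, map_sub, map_smul, oneS, fn_expo, coeffL_fourierBasis, if_pos rfl, smul_eq_mul,
          mul_one, hz, sub_self]
      rw [this]; simp
    · gcongr
      have : (1 : ℝ) ≤ |(k : ℝ)| := by exact_mod_cast Int.one_le_abs hk
      exact le_mul_of_one_le_left (norm_nonneg _) this
  have hone : fn oneS = toL2 1 := by rw [← toL2_cont, cont_oneS]
  have hnone : ‖z • fn oneS‖ = ‖z‖ := by
    rw [norm_smul, oneS, fn_expo, (fourierBasis (T := 2 * π)).orthonormal.1 0, mul_one]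
  -- As `a` has mean value `1 / c`, the mean value `z` of `u` is seen by the weight `a`.
  have h2 : d.c * wInt a (z • fn oneS) = ‖z‖ ^ 2 := by
    have e : wInt a (z • fn oneS) = ‖z‖ ^ 2 * ∫ x, a x ∂haar := by
      rw [wInt, map_smul, inner_smul_left, inner_smul_right, hone, cmul_toL2, mul_one, inner_toL2,
        ← mul_assoc, Complex.conj_mul', ← Complex.ofReal_pow, Complex.re_ofReal_mul]
      congr 1
      have : ∫ x, conj ((1 : C(Torus, ℂ)) x) * ofRealC a x ∂haar
          = ((∫ x, a x ∂haar : ℝ) : ℂ) := by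
        rw [← integral_complex_ofReal]; simp
      rw [this, Complex.ofReal_re]
    rw [e, mul_left_comm, d.mean, mul_one]
  have h3 : wInt a (z • fn oneS) ≤ 2 * wInt a (fn u) + 2 * (‖a‖ * ‖dx u‖ ^ 2) := by
    have e : z • fn oneS = fn u + -fn v := by rw [hfv]; abel
    have h4 : wInt a (-fn v) ≤ ‖a‖ * ‖dx u‖ ^ 2 := by
      refine (wInt_le_norm a _).trans ?_
      rw [norm_neg]; gcongr
    rw [e]
    exact (wInt_add_le d.nonneg _ _).trans (by linarith)
  have h5 : ‖fn u‖ ^ 2 ≤ 2 * ‖fn v‖ ^ 2 + 2 * ‖z‖ ^ 2 := by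
    have e : fn u = fn v + z • fn oneS := by rw [hfv]; abel
    have := pow_le_pow_left₀ (norm_nonneg _) (norm_add_le (fn v) (z • fn oneS)) 2
    rw [← e, hnone] at this
    nlinarith [sq_nonneg (‖fn v‖ - ‖z‖)]
  have h6 := mul_le_mul_of_nonneg_left h3 hc.le
  have h7 := wInt_nonneg d.nonneg (fn u)
  have h8 : 0 ≤ d.c * ‖a‖ * wInt a (fn u) := by positivity
  have h9 : 0 ≤ d.c * ‖dx u‖ ^ 2 := by positivity
  nlinarith [sq_nonneg ‖dx u‖]

end Estimates

/-! ### The Lyapunov functional -/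

/-- The energy with respect to the normalized measure, for the power `p = 2m + 1`. -/
def baseEnergy (m : ℕ) (u : Sob) : ℝ :=
  1 / 2 * ‖fn u‖ ^ 2 + 1 / 2 * ‖dx u‖ ^ 2 + (2 * ((m : ℝ) + 1))⁻¹ * powInt (m + 1) u

/-- The Lyapunov functional: the energy with a large multiple `K` of the mass, corrected by a small
multiple `δ` of the virial functional. -/
def lyapunov (φ : Sob) (m : ℕ) (K δ : ℝ) (u : Sob) : ℝ :=
  K * ‖fn u‖ ^ 2 + 1 / 2 * ‖dx u‖ ^ 2 + (2 * ((m : ℝ) + 1))⁻¹ * powInt (m + 1) u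
    - δ * virial φ u

/-- The derivative of the Lyapunov functional along `u_t = i u_xx + f`, where `ψ` is the derivative
of the multiplier `φ`. -/
def lyapunovDeriv (φ ψ : Sob) (m : ℕ) (K δ : ℝ) (u f : Sob) : ℝ :=
  K * (2 * (⟪fn u, fn f⟫_ℂ).re)
    + ((⟪dx u, dx f⟫_ℂ).re + ((⟪dx (nonlin m u), dx u⟫_ℂ).im + (⟪fn (nonlin m u), fn f⟫_ℂ).re))
    - δ * (2 * (⟪dx u, cmul (cont ψ) (dx u)⟫_ℂ).re + (⟪cmul (cont u) (dx ψ), dx u⟫_ℂ).re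
        - (2 * (⟪cmul (cont φ) (dx u), fn f⟫_ℂ).im + (⟪cmul (cont ψ) (fn u), fn f⟫_ℂ).im))

theorem isDerivAlong_lyapunov {φ ψ : Sob} (hφ : star (cont φ) = cont φ) (hd : dx φ = fn ψ) (m : ℕ)
    (K δ : ℝ) : IsDerivAlong (lyapunov φ m K δ) (lyapunovDeriv φ ψ m K δ) := by
  intro w t z y f hw hz hy
  have h1 := (isDerivAlong_mass w t z y f hw hz hy).const_mul K
  have h2 := (isDerivAlong_kinetic w t z y f hw hz hy).const_mul (1 / 2)
  have h3 := (isDerivAlong_potential m w t z y f hw hz hy).const_mul ((2 * ((m : ℝ) + 1))⁻¹)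
  have h4 := (isDerivAlong_virial hφ hd w t z y f hw hz hy).const_mul δ
  refine (((h1.add h2).add h3).sub h4).congr_deriv ?_
  have hm : (2 * ((m : ℝ) + 1)) ≠ 0 := by positivity
  rw [lyapunovDeriv, inv_mul_cancel_left₀ hm]
  ring

theorem LipOnBalls.inner_re {E : Type*} [NormedAddCommGroup E] {X Y : E → L2} (hX : LipOnBalls X)
    (hY : LipOnBalls Y) : LipOnBalls fun q => (⟪X q, Y q⟫_ℂ).re :=
  LipOnBalls.biadd (B := fun f g => (⟪f, g⟫_ℂ).re) (K := 1) zero_le_one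
    (fun _ _ _ => by rw [inner_sub_left, Complex.sub_re])
    (fun _ _ _ => by rw [inner_sub_right, Complex.sub_re])
    (fun f g => by
      rw [one_mul]; exact (Complex.abs_re_le_norm _).trans (norm_inner_le_norm _ _)) hX hY

theorem LipOnBalls.inner_im {E : Type*} [NormedAddCommGroup E] {X Y : E → L2} (hX : LipOnBalls X)
    (hY : LipOnBalls Y) : LipOnBalls fun q => (⟪X q, Y q⟫_ℂ).im :=
  LipOnBalls.biadd (B := fun f g => (⟪f, g⟫_ℂ).im) (K := 1) zero_le_one
    (fun _ _ _ => by rw [inner_sub_left, Complex.sub_im])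
    (fun _ _ _ => by rw [inner_sub_right, Complex.sub_im])
    (fun f g => by
      rw [one_mul]; exact (Complex.abs_im_le_norm _).trans (norm_inner_le_norm _ _)) hX hY

theorem LipOnBalls.add {E F : Type*} [NormedAddCommGroup E] [NormedAddCommGroup F] {G H : E → F}
    (hG : LipOnBalls G) (hH : LipOnBalls H) : LipOnBalls fun u => G u + H u := fun R hR => by
  obtain ⟨C, hC, h1⟩ := hG R hR
  obtain ⟨D, hD, h2⟩ := hH R hR
  refine ⟨C + D, by positivity, fun u v hu hv => ?_⟩
  rw [add_sub_add_comm, add_mul]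
  exact (norm_add_le _ _).trans (add_le_add (h1 u v hu hv) (h2 u v hu hv))

theorem LipOnBalls.const_mul {E : Type*} [NormedAddCommGroup E] {G : E → ℝ} (hG : LipOnBalls G)
    (c : ℝ) : LipOnBalls fun u => c * G u :=
  (LipOnBalls.of_clm (c • ContinuousLinearMap.id ℝ ℝ)).comp hG

theorem lipOnBalls_clm {E F : Type*} [NormedAddCommGroup E] [NormedAddCommGroup F]
    [NormedSpace ℂ E] [NormedSpace ℂ F] (A : E →L[ℂ] F) : LipOnBalls A :=
  LipOnBalls.of_clm (A.restrictScalars ℝ)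

theorem lipOnBalls_lyapunovDeriv (φ ψ : Sob) (m : ℕ) (K δ : ℝ) :
    LipOnBalls fun q : Sob × Sob => lyapunovDeriv φ ψ m K δ q.1 q.2 := by
  have hu : LipOnBalls fun q : Sob × Sob => q.1 :=
    lipOnBalls_clm (ContinuousLinearMap.fst ℂ Sob Sob)
  have hf : LipOnBalls fun q : Sob × Sob => q.2 :=
    lipOnBalls_clm (ContinuousLinearMap.snd ℂ Sob Sob)
  have hN := (lipOnBalls_nonlin m).comp hu
  have fu := (lipOnBalls_clm fn).comp hu
  have du := (lipOnBalls_clm dx).comp hu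
  have ff := (lipOnBalls_clm fn).comp hf
  have df := (lipOnBalls_clm dx).comp hf
  have fN := (lipOnBalls_clm fn).comp hN
  have dN := (lipOnBalls_clm dx).comp hN
  have ψd := (lipOnBalls_clm (cmul (cont ψ))).comp du
  have φd := (lipOnBalls_clm (cmul (cont φ))).comp du
  have ψf := (lipOnBalls_clm (cmul (cont ψ))).comp fu
  have uψ := LipOnBalls.bilin cmul ((lipOnBalls_clm cont).comp hu) (LipOnBalls.const (dx ψ))
  exact ((((fu.inner_re ff).const_mul 2).const_mul K).add
    ((du.inner_re df).add ((dN.inner_im du).add (fN.inner_re ff)))).sub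
    (((((du.inner_re ψd).const_mul 2).add (uψ.inner_re du)).sub
      (((φd.inner_im ff).const_mul 2).add (ψf.inner_im ff))).const_mul δ)

theorem continuous_lyapunov (φ : Sob) (m : ℕ) (K δ : ℝ) : Continuous (lyapunov φ m K δ) := by
  have h1 := fn.continuous
  have h2 := dx.continuous
  have h3 := cont.continuous
  have h4 : Continuous (powInt (m + 1)) := by
    have : Continuous fun u : Sob => toL2 ((cont u * star (cont u)) ^ (m + 1)) := by fun_prop
    exact Complex.continuous_re.comp (continuous_const.inner this)
  have h5 : Continuous (virial φ) :=
    Complex.continuous_im.comp (h1.inner ((cmul (cont φ)).continuous.comp h2))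
  unfold lyapunov
  fun_prop

theorem VirialData.lyapunovDeriv_eq {a : C(Torus, ℝ)} (d : VirialData a) (m : ℕ) (K δ : ℝ)
    (u : Sob) :
    lyapunovDeriv d.φS d.ψS m K δ u (field d.aS m u)
      = -(2 * K * wInt a (fn u))
        + (-wInt a (dx u) - pInt a (m + 1) u - d.commutator u)
        - δ * (2 * (‖dx u‖ ^ 2 - d.c * wInt a (dx u)) - d.c * d.commutator u
          + (1 - ((m : ℝ) + 1)⁻¹) * (powInt (m + 1) u - d.c * pInt a (m + 1) u)
          + 2 * d.mixed u) := by
  rw [lyapunovDeriv, d.mass_balance, d.energy_balance, d.virial_balance]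
  ring

/-- The elementary inequality behind the decay of the Lyapunov functional. Of the gain `2 δ A`, the
commutator `Q` costs `δ A / 2` and the mixed term `Y` costs `δ A / 2`. They also cost the multiples
`D / (2 δ)` and `2 δ α` of `Ma`, which `K` is chosen to absorb. -/
theorem dissipation_le {A B Ma Aa Ba Q Y c D α δ θ K : ℝ} (hA : 0 ≤ A) (hB : 0 ≤ B)
    (hMa : 0 ≤ Ma) (hAa : 0 ≤ Aa) (hBa : 0 ≤ Ba) (hc : 0 < c) (hD : 0 ≤ D) (hα : 0 ≤ α)
    (hδ : 0 < δ) (hδc : 2 * c * δ ≤ 1) (hθ : 1 / 2 ≤ θ) (hθ1 : θ ≤ 1)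
    (hQ : Q ^ 2 ≤ D * A * Ma) (hY : Y ^ 2 ≤ α * A * Ma) (hK : K = 1 + D / (4 * δ) + δ * α) :
    -(2 * K * Ma) + (-Aa - Ba - Q) - δ * (2 * (A - c * Aa) - c * Q + θ * (B - c * Ba) + 2 * Y)
      ≤ -(2 * Ma) - δ * A - δ / 2 * B := by
  have hQ' : |Q| ≤ δ / 2 * A + D / (2 * δ) * Ma := by
    refine abs_le_of_sq_le_sq ?_ (by positivity)
    have e : (δ / 2 * A + D / (2 * δ) * Ma) ^ 2
        = (δ / 2 * A - D / (2 * δ) * Ma) ^ 2 + D * A * Ma := by field_simp; ring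
    rw [e]; nlinarith [sq_nonneg (δ / 2 * A - D / (2 * δ) * Ma)]
  have hY' : 2 * |Y| ≤ 1 / 2 * A + 2 * α * Ma := by
    have : |2 * Y| ≤ 1 / 2 * A + 2 * α * Ma := by
      refine abs_le_of_sq_le_sq ?_ (by positivity)
      nlinarith [sq_nonneg (1 / 2 * A - 2 * α * Ma)]
    rwa [abs_mul, abs_two] at this
  have h1 : -Q * (1 - δ * c) ≤ |Q| := by
    have h2 : 0 ≤ 1 - δ * c := by nlinarith
    have h3 : 1 - δ * c ≤ 1 := by nlinarith
    nlinarith [neg_abs_le Q, le_abs_self Q, abs_nonneg Q]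
  have h2 : 0 ≤ Aa * (1 - 2 * c * δ) := mul_nonneg hAa (by linarith)
  have h3 : 0 ≤ Ba * (1 - δ * θ * c) := mul_nonneg hBa (by nlinarith [mul_pos hc hδ])
  have h4 : δ * (-2 * Y) ≤ δ * (1 / 2 * A + 2 * α * Ma) := by
    gcongr; linarith [neg_abs_le Y]
  have h5 : δ * B * (1 / 2) ≤ δ * B * θ := by gcongr
  have h6 : 2 * K * Ma = 2 * Ma + D / (2 * δ) * Ma + 2 * δ * α * Ma := by
    rw [hK]; field_simp; ring
  nlinarith

/-- There is a Lyapunov functional, comparable to the energy and decaying at a rate which does not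
depend on the size of the solution. -/
theorem VirialData.exists_lyapunov {a : C(Torus, ℝ)} (d : VirialData a) {m : ℕ} (hm : 1 ≤ m) :
    ∃ K δ β C : ℝ, 0 < β ∧ 0 < C ∧ ∀ u : Sob,
      lyapunovDeriv d.φS d.ψS m K δ u (field d.aS m u) ≤ -β * lyapunov d.φS m K δ u ∧
      baseEnergy m u ≤ 2 * lyapunov d.φS m K δ u ∧
      lyapunov d.φS m K δ u ≤ C * baseEnergy m u := by
  have hc := d.c_pos
  have hD := d.D_nonneg
  have hΦ := norm_nonneg d.φ
  set Φ := ‖d.φ‖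
  set α := Φ ^ 2 * ‖a‖ with hα
  have hα0 : 0 ≤ α := by positivity
  -- `δ` is small enough that `2 c δ ≤ 1`, and that `δ P` is at most a quarter of `M + A`.
  set δ := (1 + 2 * d.c + 2 * Φ)⁻¹ with hδ
  have hδ0 : 0 < δ := by positivity
  have hδe : δ * (1 + 2 * d.c + 2 * Φ) = 1 := inv_mul_cancel₀ (by positivity)
  have hδ1 : δ ≤ 1 := by nlinarith [mul_pos hδ0 hc, mul_nonneg hδ0.le hΦ]
  have hδc : 2 * d.c * δ ≤ 1 := by nlinarith [mul_pos hδ0 hc, mul_nonneg hδ0.le hΦ]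
  have hδΦ : δ * Φ ≤ 1 / 2 := by nlinarith [mul_pos hδ0 hc, mul_nonneg hδ0.le hΦ]
  set K := 1 + d.D / (4 * δ) + δ * α with hK
  have hK1 : 1 ≤ K := by
    have : 0 ≤ d.D / (4 * δ) + δ * α := by positivity
    linarith
  set κ := 4 * d.c + 4 * d.c * ‖a‖ + 2 with hκ
  have hκ0 : 0 < κ := by positivity
  have hG : 0 < (K + 1) * κ + 1 := by positivity
  refine ⟨K, δ, δ / 2 / ((K + 1) * κ + 1), 2 * (K + 1), by positivity, by linarith, fun u => ?_⟩
  have hM := sq_nonneg ‖fn u‖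
  have hA := sq_nonneg ‖dx u‖
  have hB := powInt_nonneg (m + 1) u
  have hMa := wInt_nonneg d.nonneg (fn u)
  have hAa := wInt_nonneg d.nonneg (dx u)
  have hBa := pInt_nonneg d.nonneg (m + 1) u
  have hm' : (1 : ℝ) ≤ m := by exact_mod_cast hm
  have hi : ((m : ℝ) + 1)⁻¹ ≤ 1 / 2 := by
    rw [inv_le_comm₀ (by positivity) (by norm_num)]; linarith
  have hi0 : 0 < ((m : ℝ) + 1)⁻¹ := by positivity
  have hj : (2 * ((m : ℝ) + 1))⁻¹ ≤ 1 := by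
    rw [mul_inv]; linarith
  have hj0 : 0 < (2 * ((m : ℝ) + 1))⁻¹ := by positivity
  have hP := d.abs_virial_le u
  have hpc := d.poincare u
  have hdis := dissipation_le hA hB hMa hAa hBa hc hD hα0 hδ0 hδc (θ := 1 - ((m : ℝ) + 1)⁻¹)
    (by linarith) (by linarith) (d.sq_commutator_le u) (d.sq_mixed_le u) hK
  rw [d.lyapunovDeriv_eq]
  set M := ‖fn u‖ ^ 2 with hMdef
  set A := ‖dx u‖ ^ 2 with hAdef
  set B := powInt (m + 1) u with hBdef
  set Ma := wInt a (fn u)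
  have hP' : δ * |virial d.φS u| ≤ 1 / 4 * (M + A) := by
    have h1 : ‖fn u‖ * ‖dx u‖ ≤ 1 / 2 * (M + A) := by
      nlinarith [sq_nonneg (‖fn u‖ - ‖dx u‖)]
    calc δ * |virial d.φS u| ≤ δ * (Φ * ‖fn u‖ * ‖dx u‖) := by gcongr
      _ = (δ * Φ) * (‖fn u‖ * ‖dx u‖) := by ring
      _ ≤ 1 / 2 * (1 / 2 * (M + A)) := by gcongr
      _ = _ := by ring
  have hP1 : δ * virial d.φS u ≤ 1 / 4 * (M + A) :=
    (mul_le_mul_of_nonneg_left (le_abs_self _) hδ0.le).trans hP'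
  have hP2 : -(δ * virial d.φS u) ≤ 1 / 4 * (M + A) := by
    have := mul_le_mul_of_nonneg_left (neg_abs_le (virial d.φS u)) hδ0.le
    linarith
  have hL : lyapunov d.φS m K δ u
      = K * M + 1 / 2 * A + (2 * ((m : ℝ) + 1))⁻¹ * B - δ * virial d.φS u := rfl
  have hE : baseEnergy m u = 1 / 2 * M + 1 / 2 * A + (2 * ((m : ℝ) + 1))⁻¹ * B := rfl
  have hjB : (2 * ((m : ℝ) + 1))⁻¹ * B ≤ B := mul_le_of_le_one_left hB hj
  have hjB0 : 0 ≤ (2 * ((m : ℝ) + 1))⁻¹ * B := by positivity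
  have hKM : M ≤ K * M := le_mul_of_one_le_left hM hK1
  have hKA : A ≤ K * A := le_mul_of_one_le_left hA hK1
  refine ⟨hdis.trans ?_, ?_, ?_⟩
  · have hup : lyapunov d.φS m K δ u ≤ ((K + 1) * κ + 1) * (Ma + A + B) := by
      have h1 : (K + 1) * M ≤ (K + 1) * (κ * (A + Ma)) := by gcongr
      have h2 : 0 ≤ (K + 1) * κ * B := by positivity
      have e : ((K + 1) * κ + 1) * (Ma + A + B)
          = (K + 1) * (κ * (A + Ma)) + (K + 1) * κ * B + (Ma + A + B) := by ring
      have e' : (K + 1) * M = K * M + M := by ring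
      rw [hL, e]; linarith
    have h3 : δ / 2 / ((K + 1) * κ + 1) * lyapunov d.φS m K δ u ≤ δ / 2 * (Ma + A + B) := by
      calc _ ≤ δ / 2 / ((K + 1) * κ + 1) * (((K + 1) * κ + 1) * (Ma + A + B)) := by gcongr
        _ = _ := by field_simp
    have h4 := mul_nonneg hδ0.le hA
    have h5 := mul_le_mul_of_nonneg_right hδ1 hMa
    have e : δ / 2 * (Ma + A + B) = 1 / 2 * (δ * Ma) + 1 / 2 * (δ * A) + δ / 2 * B := by ring
    rw [neg_mul]
    linarith
  · rw [hL, hE]; linarith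
  · rw [hL, hE]
    have h1 := le_mul_of_one_le_left hjB0 hK1
    have e : ∀ x : ℝ, 2 * (K + 1) * (1 / 2 * M + 1 / 2 * A + x)
        = K * M + M + (K * A + A) + 2 * (K * x) + 2 * x := fun x => by ring
    rw [e]
    linarith

/-- Exponential decay of the Lyapunov functional along solutions on a time interval. -/
theorem VirialData.lyapunov_decay {a : C(Torus, ℝ)} (d : VirialData a) {m : ℕ} {K δ β : ℝ}
    (hβ : ∀ u : Sob, lyapunovDeriv d.φS d.ψS m K δ u (field d.aS m u)
      ≤ -β * lyapunov d.φS m K δ u)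
    (x₀ : Sob) {f : ℝ → Sob} (hf : Continuous f) {T : ℝ}
    (hfT : ∀ t ∈ Set.Ioo 0 T, f t = field d.aS m (mild x₀ f t)) {t : ℝ} (ht : t ∈ Set.Icc 0 T) :
    lyapunov d.φS m K δ (mild x₀ f t) ≤ lyapunov d.φS m K δ x₀ * Real.exp (-β * t) := by
  have hφ : star (cont d.φS) = cont d.φS := by rw [d.cont_φS, star_ofRealC]
  have hd : dx d.φS = fn d.ψS := by
    rw [← toL2_cont d.ψS, d.cont_ψS, d.dx_φS_eq]
  have h1 := fun t => (isDerivAlong_lyapunov hφ hd m K δ).hasDerivAt_mild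
    (continuous_lyapunov d.φS m K δ) (lipOnBalls_lyapunovDeriv d.φS d.ψS m K δ) x₀ hf t
  set ℓ := fun τ => lyapunov d.φS m K δ (mild x₀ f τ) with hℓ
  have h2 : ∀ t, HasDerivAt (fun τ => Real.exp (β * τ) * ℓ τ)
      (Real.exp (β * t) * (β * ℓ t + lyapunovDeriv d.φS d.ψS m K δ (mild x₀ f t) (f t))) t :=
    fun t => by
      have h3 : HasDerivAt (fun τ => Real.exp (β * τ)) (Real.exp (β * t) * (β * 1)) t :=
        ((hasDerivAt_id t).const_mul β).exp
      exact (h3.mul (h1 t)).congr_deriv (by ring)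
  have hanti : AntitoneOn (fun τ => Real.exp (β * τ) * ℓ τ) (Set.Icc 0 T) := by
    refine antitoneOn_of_hasDerivWithinAt_nonpos (convex_Icc 0 T)
      (fun t _ => (h2 t).continuousAt.continuousWithinAt)
      (fun t _ => (h2 t).hasDerivWithinAt) fun t ht => ?_
    rw [interior_Icc] at ht
    have h4 := hβ (mild x₀ f t)
    rw [← hfT t ht] at h4
    exact mul_nonpos_of_nonneg_of_nonpos (Real.exp_nonneg _) (by linarith)
  have h5 := hanti (Set.left_mem_Icc.2 (ht.1.trans ht.2)) ht ht.1
  simp only [hℓ, mul_zero, Real.exp_zero, one_mul, mild_zero] at h5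
  have h6 : Real.exp (-β * t) * Real.exp (β * t) = 1 := by
    rw [← Real.exp_add]; simp
  calc lyapunov d.φS m K δ (mild x₀ f t)
      = Real.exp (-β * t) * (Real.exp (β * t) * lyapunov d.φS m K δ (mild x₀ f t)) := by
        rw [← mul_assoc, h6, one_mul]
    _ ≤ Real.exp (-β * t) * lyapunov d.φS m K δ x₀ := by gcongr
    _ = _ := mul_comm _ _

/-! ### Existence and uniqueness of mild solutions -/

/-- `mild x₀ f` solves `u_t = i u_xx + F(u)`, `u(0) = x₀` on `[0, T]`. -/
structure IsMildSolution (F : Sob → Sob) (x₀ : Sob) (T : ℝ) (f : ℝ → Sob) : Prop where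
  continuous : Continuous f
  eq : ∀ t ∈ Set.Icc 0 T, f t = F (mild x₀ f t)

theorem IsMildSolution.mono {F : Sob → Sob} {x₀ : Sob} {T T' : ℝ} {f : ℝ → Sob}
    (h : IsMildSolution F x₀ T f) (hT : T' ≤ T) : IsMildSolution F x₀ T' f :=
  ⟨h.continuous, fun t ht => h.eq t ⟨ht.1, ht.2.trans hT⟩⟩

/-- Projection of the real line to `[0, T]`. -/
def clamp (T t : ℝ) : ℝ := max 0 (min t T)

theorem clamp_mem {T : ℝ} (hT : 0 ≤ T) (t : ℝ) : clamp T t ∈ Set.Icc 0 T :=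
  ⟨le_max_left _ _, max_le hT (min_le_right _ _)⟩

theorem clamp_of_mem {T t : ℝ} (ht : t ∈ Set.Icc 0 T) : clamp T t = t := by
  rw [clamp, min_eq_left ht.2, max_eq_right ht.1]

theorem continuous_comp_clamp {T : ℝ} (hT : 0 ≤ T) {g : ℝ → Sob}
    (hg : ContinuousOn g (Set.Icc 0 T)) : Continuous fun t => g (clamp T t) :=
  hg.comp_continuous (by unfold clamp; fun_prop) (clamp_mem hT)

theorem IsMildSolution.eqOn {F : Sob → Sob} (hF : LipOnBalls F) {x₀ : Sob} {T : ℝ}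
    {f g : ℝ → Sob} (hf : IsMildSolution F x₀ T f) (hg : IsMildSolution F x₀ T g) :
    Set.EqOn (mild x₀ f) (mild x₀ g) (Set.Icc 0 T) := by
  set wf := fun t => x₀ + ∫ τ in (0 : ℝ)..t, grp (-τ) (f τ) with hwf
  set wg := fun t => x₀ + ∫ τ in (0 : ℝ)..t, grp (-τ) (g τ) with hwg
  have df := fun t => hasDerivAt_interaction x₀ hf.continuous t
  have dg := fun t => hasDerivAt_interaction x₀ hg.continuous t
  have cf : Continuous wf := continuous_iff_continuousAt.2 fun t => (df t).continuousAt
  have cg : Continuous wg := continuous_iff_continuousAt.2 fun t => (dg t).continuousAt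
  obtain ⟨R₁, hR₁⟩ := (isCompact_Icc (a := (0 : ℝ)) (b := T)).exists_bound_of_continuousOn
    cf.continuousOn
  obtain ⟨R₂, hR₂⟩ := (isCompact_Icc (a := (0 : ℝ)) (b := T)).exists_bound_of_continuousOn
    cg.continuousOn
  set R := max 0 (max R₁ R₂) with hR
  obtain ⟨C, hC, hL⟩ := hF R (le_max_left _ _)
  have hlip : ∀ t ∈ Set.Ico 0 T, LipschitzOnWith C.toNNReal
      (fun x => grp (-t) (F (grp t x))) {x | ‖x‖ ≤ R} := fun t _ => by
    refine LipschitzOnWith.of_dist_le_mul fun x hx y hy => ?_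
    rw [dist_eq_norm, dist_eq_norm, ← map_sub, norm_grp, Real.coe_toNNReal _ hC]
    refine (hL _ _ (by rwa [norm_grp]) (by rwa [norm_grp])).trans ?_
    rw [← map_sub, norm_grp]
  have key := ODE_solution_unique_of_mem_Icc_right (s := fun _ => {x | ‖x‖ ≤ R})
    (v := fun t x => grp (-t) (F (grp t x))) hlip cf.continuousOn
    (fun t ht => by
      have h := (df t).hasDerivWithinAt (s := Set.Ici t)
      rwa [hf.eq t ⟨ht.1, ht.2.le⟩] at h)
    (fun t ht => (hR₁ t ⟨ht.1, ht.2.le⟩).trans ((le_max_left _ _).trans (le_max_right _ _)))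
    cg.continuousOn
    (fun t ht => by
      have h := (dg t).hasDerivWithinAt (s := Set.Ici t)
      rwa [hg.eq t ⟨ht.1, ht.2.le⟩] at h)
    (fun t ht => (hR₂ t ⟨ht.1, ht.2.le⟩).trans ((le_max_right _ _).trans (le_max_right _ _)))
    (by simp [hwf, hwg])
  intro t ht
  exact congrArg (grp t) (key ht)

/-- A bounded vector field that is Lipschitz on balls has mild solutions on every time interval. In
the interaction picture `w(t) = S(-t) u(t)` the equation is an ordinary differential equation. -/
theorem exists_isMildSolution_of_bounded {F : Sob → Sob} (hF : LipOnBalls F) {B : ℝ} (hB : 0 ≤ B)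
    (hbd : ∀ u, ‖F u‖ ≤ B) (x₀ : Sob) {T : ℝ} (hT : 0 ≤ T) : ∃ f, IsMildSolution F x₀ T f := by
  obtain ⟨C, hC, hL⟩ := hF (‖x₀‖ + B * T) (by positivity)
  have hFc := hF.continuous
  have hpl : IsPicardLindelof (fun t x => grp (-t) (F (grp t x)))
      (⟨0, Set.left_mem_Icc.2 hT⟩ : Set.Icc (0 : ℝ) T) x₀ (B * T).toNNReal 0 B.toNNReal
      C.toNNReal := by
    refine ⟨fun t _ => LipschitzOnWith.of_dist_le_mul fun x hx y hy => ?_, fun x _ => ?_,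
      fun t _ x _ => ?_, ?_⟩
    · have hn : ∀ z ∈ Metric.closedBall x₀ ((B * T).toNNReal : ℝ), ‖z‖ ≤ ‖x₀‖ + B * T :=
        fun z hz => by
          rw [Real.coe_toNNReal _ (by positivity)] at hz
          exact norm_le_norm_add_const_of_dist_le hz
      rw [dist_eq_norm, dist_eq_norm, ← map_sub, norm_grp, Real.coe_toNNReal _ hC]
      refine (hL _ _ (by rw [norm_grp]; exact hn x hx) (by rw [norm_grp]; exact hn y hy)).trans ?_
      rw [← map_sub, norm_grp]
    · exact (continuous_grp continuous_neg
        (hFc.comp (continuous_grp continuous_id continuous_const))).continuousOn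
    · rw [norm_grp, Real.coe_toNNReal _ hB]; exact hbd _
    · simp [Real.coe_toNNReal _ hB, Real.coe_toNNReal _ (mul_nonneg hB hT), hT]
  obtain ⟨w, hw0, hw⟩ := hpl.exists_eq_forall_mem_Icc_hasDerivWithinAt₀
  have hwc : ContinuousOn w (Set.Icc 0 T) := fun t ht => (hw t ht).continuousWithinAt
  have hgc : ContinuousOn (fun t => F (grp t (w t))) (Set.Icc 0 T) :=
    hFc.comp_continuousOn (continuousOn_grp continuousOn_id hwc)
  set f := fun t => F (grp (clamp T t) (w (clamp T t))) with hf
  have hfc : Continuous f := continuous_comp_clamp hT hgc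
  have hfe : ∀ t ∈ Set.Icc 0 T, f t = F (grp t (w t)) := fun t ht => by
    rw [hf]; simp only [clamp_of_mem ht]
  refine ⟨f, hfc, fun t ht => ?_⟩
  rw [hfe t ht]
  congr 1
  rw [mild]
  congr 1
  have hsub : Set.Icc 0 t ⊆ Set.Icc 0 T := Set.Icc_subset_Icc_right ht.2
  have h := intervalIntegral.integral_eq_sub_of_hasDeriv_right_of_le ht.1 (hwc.mono hsub)
    (f' := fun τ => grp (-τ) (f τ)) (fun τ hτ => by
      have hτ' : τ ∈ Set.Icc 0 T := hsub ⟨hτ.1.le, hτ.2.le⟩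
      have h1 := hw τ hτ'
      rw [← hfe τ hτ'] at h1
      exact (h1.hasDerivAt (Icc_mem_nhds hτ.1 (hτ.2.trans_le ht.2))).hasDerivWithinAt)
    ((continuous_grp continuous_neg hfc).intervalIntegrable _ _)
  rw [h, ← hw0]
  simp

/-- The cutoff `min 1 (R + 1 - ‖u‖)₊`, equal to `1` for `‖u‖ ≤ R` and to `0` for
`‖u‖ ≥ R + 1`. -/
def cutoff (R : ℝ) (u : Sob) : ℝ := max 0 (min 1 (R + 1 - ‖u‖))

theorem cutoff_eq_one {R : ℝ} {u : Sob} (h : ‖u‖ ≤ R) : cutoff R u = 1 := by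
  rw [cutoff, min_eq_left (by linarith), max_eq_right zero_le_one]

theorem cutoff_eq_zero {R : ℝ} {u : Sob} (h : R + 1 ≤ ‖u‖) : cutoff R u = 0 := by
  rw [cutoff, min_eq_right (by linarith), max_eq_left (by linarith)]

theorem cutoff_nonneg (R : ℝ) (u : Sob) : 0 ≤ cutoff R u := le_max_left _ _

theorem cutoff_le_one (R : ℝ) (u : Sob) : cutoff R u ≤ 1 := max_le zero_le_one (min_le_left _ _)

theorem lipOnBalls_cutoff (R : ℝ) : LipOnBalls (cutoff R) := fun _ _ =>
  ⟨1, zero_le_one, fun u v _ _ => by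
    have h1 : |cutoff R u - cutoff R v|
        ≤ |min 1 (R + 1 - ‖u‖) - min 1 (R + 1 - ‖v‖)| := by
      have := abs_max_sub_max_le_max 0 (min 1 (R + 1 - ‖u‖)) 0 (min 1 (R + 1 - ‖v‖))
      simpa [cutoff] using this
    have h2 : |min 1 (R + 1 - ‖u‖) - min 1 (R + 1 - ‖v‖)| ≤ |(R + 1 - ‖u‖) - (R + 1 - ‖v‖)| := by
      have := abs_min_sub_min_le_max 1 (R + 1 - ‖u‖) 1 (R + 1 - ‖v‖)
      simpa using this
    have h3 : |(R + 1 - ‖u‖) - (R + 1 - ‖v‖)| ≤ ‖u - v‖ := by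
      rw [sub_sub_sub_cancel_left, abs_sub_comm]; exact abs_norm_sub_norm_le u v
    rw [one_mul, Real.norm_eq_abs]
    exact h1.trans (h2.trans h3)⟩

/-- An a priori bound for the solutions yields solutions on every time interval. -/
theorem exists_isMildSolution {F : Sob → Sob} (hF : LipOnBalls F) {x₀ : Sob} {ρ : ℝ}
    (hx₀ : ‖x₀‖ ≤ ρ)
    (hap : ∀ f : ℝ → Sob, Continuous f → ∀ T, 0 ≤ T →
      (∀ t ∈ Set.Ioo 0 T, f t = F (mild x₀ f t)) → ‖mild x₀ f T‖ ≤ ρ)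
    {T : ℝ} (hT : 0 ≤ T) : ∃ f, IsMildSolution F x₀ T f := by
  have hρ : 0 ≤ ρ := (norm_nonneg _).trans hx₀
  set R := ρ + 1 with hR
  have hcut : LipOnBalls fun u => cutoff R u • F u :=
    LipOnBalls.biadd (B := fun (r : ℝ) (u : Sob) => r • u) zero_le_one (fun _ _ _ => sub_smul _ _ _)
      (fun _ _ _ => smul_sub _ _ _) (fun r u => by rw [norm_smul, one_mul]) (lipOnBalls_cutoff R) hF
  obtain ⟨B, hB, hbd⟩ := hF.bounded (R + 1) (by positivity)
  obtain ⟨f, hf⟩ := exists_isMildSolution_of_bounded hcut hB (fun u => by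
    rcases le_total ‖u‖ (R + 1) with h | h
    · rw [norm_smul, Real.norm_of_nonneg (cutoff_nonneg R u)]
      exact (mul_le_of_le_one_left (norm_nonneg _) (cutoff_le_one R u)).trans (hbd u h)
    · rw [cutoff_eq_zero h, zero_smul, norm_zero]; exact hB) x₀ hT
  have huc := continuous_mild x₀ hf.continuous
  have hlt : ∀ t ∈ Set.Icc 0 T, ‖mild x₀ f t‖ < R := by
    by_contra! hcon
    -- the first time at which the solution leaves the ball where the cutoff is inactive
    have hS : IsCompact {t ∈ Set.Icc 0 T | R ≤ ‖mild x₀ f t‖} :=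
      isCompact_Icc.inter_right (isClosed_le continuous_const huc.norm)
    obtain ⟨s, ⟨hs, hsR⟩, hmin⟩ := hS.exists_isLeast hcon
    have hb : ‖mild x₀ f s‖ ≤ ρ := hap f hf.continuous s hs.1 fun t ht => by
      have htT : t ∈ Set.Icc 0 T := ⟨ht.1.le, ht.2.le.trans hs.2⟩
      rw [hf.eq t htT, cutoff_eq_one, one_smul]
      by_contra! h
      exact absurd (hmin ⟨htT, h.le⟩) (not_le.2 ht.2)
    linarith
  exact ⟨f, hf.continuous, fun t ht => by
    rw [hf.eq t ht, cutoff_eq_one (hlt t ht).le, one_smul]⟩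

/-! ### Strong solutions -/

/-- The Duhamel formula in `L²` for mild solutions. -/
theorem fn_mild (x₀ : Sob) {f : ℝ → Sob} (hf : Continuous f) (t : ℝ) :
    fn (mild x₀ f t) = freeGroup t (fn x₀) + ∫ τ in (0 : ℝ)..t, freeGroup (t - τ) (fn (f τ)) := by
  rw [mild, map_add, map_add, fn_grp]
  congr 1
  have hi : IntervalIntegrable (fun τ => grp (-τ) (f τ)) volume 0 t :=
    (continuous_grp continuous_neg hf).intervalIntegrable _ _
  have h := (((fn.comp (grp t)).restrictScalars ℝ)).intervalIntegral_comp_comm hi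
  refine h.symm.trans (intervalIntegral.integral_congr fun τ _ => ?_)
  change fn (grp t (grp (-τ) (f τ))) = _
  rw [grp_grp, fn_grp, sub_eq_add_neg]

/-- A strong solution is a mild solution. -/
theorem IsStrongSolution.exists_isMildSolution {a : C(Torus, ℝ)} {aS : Sob}
    (ha : cont aS = ofRealC a) (m : ℕ) {u₀ : H1} {v : ℝ → H1}
    (hv : IsStrongSolution a (2 * m + 1) u₀ v) {T : ℝ} (hT : 0 ≤ T) :
    ∃ f, IsMildSolution (field aS m) (toSob u₀) T f ∧
      ∀ t ∈ Set.Icc 0 T, mild (toSob u₀) f t = toSob (v t) := by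
  have hc : ContinuousOn (fun t => toSob (v t)) (Set.Icc 0 T) := fun t ht => by
    have h := (hv.continuous t ht.1).mono_left
      (nhdsWithin_mono t (fun x hx => hx.1 : Set.Icc 0 T ⊆ Set.Ici 0))
    rw [ContinuousWithinAt, tendsto_iff_norm_sub_tendsto_zero]
    refine squeeze_zero (fun _ => norm_nonneg _) (fun s => ?_) h
    rw [← map_sub]
    exact norm_toSob_le _
  have hgc := (lipOnBalls_field aS m).continuous.comp_continuousOn hc
  set f := fun t => field aS m (toSob (v (clamp T t))) with hf
  have hfc : Continuous f := continuous_comp_clamp hT hgc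
  have hfe : ∀ t ∈ Set.Icc 0 T, f t = field aS m (toSob (v t)) := fun t ht => by
    rw [hf]; simp only [clamp_of_mem ht]
  have key : ∀ t ∈ Set.Icc 0 T, mild (toSob u₀) f t = toSob (v t) := fun t ht => by
    refine fn_injective ?_
    rw [fn_mild _ hfc, fn_toSob, fn_toSob, hv.duhamel t ht.1]
    congr 1
    refine intervalIntegral.integral_congr fun τ hτ => ?_
    rw [Set.uIcc_of_le ht.1] at hτ
    have : f τ = field aS m (toSob (v τ)) := hfe τ ⟨hτ.1, hτ.2.trans ht.2⟩
    simp only [this, fn_field ha]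
  exact ⟨f, ⟨hfc, fun t ht => by rw [key t ht, hfe t ht]⟩, key⟩

/-- A function that agrees with mild solutions on all bounded intervals is a strong solution. -/
theorem isStrongSolution_of_isMildSolution {a : C(Torus, ℝ)} {aS : Sob}
    (ha : cont aS = ofRealC a) (m : ℕ) {u₀ : H1} {y : ℝ → Sob}
    (h : ∀ n : ℕ, ∃ f, IsMildSolution (field aS m) (toSob u₀) n f ∧
      ∀ t ∈ Set.Icc (0 : ℝ) n, y t = mild (toSob u₀) f t) :
    IsStrongSolution a (2 * m + 1) u₀ fun t => ofSob (y t) where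
  continuous := fun t₀ ht₀ => by
    obtain ⟨n, hn⟩ := exists_nat_gt t₀
    obtain ⟨f, hf, hy⟩ := h n
    have hc := (continuous_mild (toSob u₀) hf.continuous).tendsto t₀
    have h1 : Tendsto (fun t => √(4 * π) * ‖mild (toSob u₀) f t - mild (toSob u₀) f t₀‖)
        (𝓝[Set.Ici 0] t₀) (𝓝 0) := by
      simpa using ((tendsto_iff_norm_sub_tendsto_zero.1 hc).mono_left
        nhdsWithin_le_nhds).const_mul (√(4 * π))
    refine squeeze_zero' (Eventually.of_forall fun _ => Real.sqrt_nonneg _) ?_ h1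
    filter_upwards [self_mem_nhdsWithin, mem_nhdsWithin_of_mem_nhds (Iio_mem_nhds hn)] with t ht ht'
    have h2 := h1Norm_le (ofSob (y t) - ofSob (y t₀))
    rw [map_sub, toSob_ofSob, toSob_ofSob] at h2
    rwa [← hy t ⟨ht, le_of_lt ht'⟩, ← hy t₀ ⟨ht₀, hn.le⟩]
  duhamel := fun t ht => by
    obtain ⟨n, hn⟩ := exists_nat_ge t
    obtain ⟨f, hf, hy⟩ := h n
    change fn (y t) = _
    rw [hy t ⟨ht, hn⟩, fn_mild _ hf.continuous, fn_toSob]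
    congr 1
    refine intervalIntegral.integral_congr fun τ hτ => ?_
    rw [Set.uIcc_of_le ht] at hτ
    have hτ' : τ ∈ Set.Icc (0 : ℝ) n := ⟨hτ.1, hτ.2.trans hn⟩
    simp only [hf.eq τ hτ', hy τ hτ', ← fn_field ha, toSob_ofSob]

theorem norm_sq_eq_integral (f : L2) : ‖f‖ ^ 2 = ∫ x, ‖f x‖ ^ 2 ∂haar := by
  rw [norm_sq_eq_re_inner, L2.inner_def]
  have e : ∀ x, ⟪f x, f x⟫_ℂ = ((‖f x‖ ^ 2 : ℝ) : ℂ) := fun x => by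
    rw [inner_self_eq_norm_sq_to_K]; norm_cast
  simp only [e]
  rw [integral_complex_ofReal, Complex.ofReal_re]

theorem integral_torus (g : Torus → ℝ) : ∫ x, g x = 2 * π * ∫ x, g x ∂haar := by
  rw [AddCircle.volume_eq_smul_haarAddCircle, integral_smul_measure,
    ENNReal.toReal_ofReal Real.two_pi_pos.le, smul_eq_mul]

theorem energy_eq (m : ℕ) (u : H1) : energy (2 * m + 1) u = 2 * π * baseEnergy m (toSob u) := by
  have h : ∫ x, ‖(u : L2) x‖ ^ (2 * m + 1 + 1) ∂haar = powInt (m + 1) (toSob u) := by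
    rw [powInt_eq, pInt]
    refine integral_congr_ae ?_
    filter_upwards [coeFn_fn (toSob u)] with x hx
    rw [← fn_toSob, hx]
    simp [mul_add]
  rw [energy, baseEnergy, integral_torus, integral_torus, integral_torus, h, norm_sq_eq_integral,
    norm_sq_eq_integral, fn_toSob, dx_toSob]
  push_cast
  have : (2 * (m : ℝ) + 1 + 1) = 2 * ((m : ℝ) + 1) := by ring
  rw [this]
  field_simp

theorem norm_sq_le_baseEnergy (m : ℕ) (u : Sob) : ‖u‖ ^ 2 ≤ 2 * baseEnergy m u := by
  have h1 := powInt_nonneg (m + 1) u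
  have h2 : 0 ≤ (2 * ((m : ℝ) + 1))⁻¹ * powInt (m + 1) u := by positivity
  rw [baseEnergy, norm_sob]
  rcases max_cases ‖fn u‖ ‖dx u‖ with ⟨h, -⟩ | ⟨h, -⟩ <;> rw [h] <;>
    nlinarith [sq_nonneg ‖fn u‖, sq_nonneg ‖dx u‖]

theorem baseEnergy_nonneg (m : ℕ) (u : Sob) : 0 ≤ baseEnergy m u := by
  linarith [norm_sq_le_baseEnergy m u, sq_nonneg ‖u‖]

end

end NLS

theorem proposition2p2 (p : ℕ) (hp : 3 ≤ p) (hodd : Odd p)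
    (a : C(NLS.Torus, ℝ)) (ha : NLS.IsLocalizedDamping a) :
    ∃ C β : ℝ, 0 < C ∧ 0 < β ∧ ∀ u₀ : NLS.H1,
      ∃ u : ℝ → NLS.H1, NLS.IsStrongSolution a p u₀ u ∧
        (∀ v : ℝ → NLS.H1, NLS.IsStrongSolution a p u₀ v → ∀ t : ℝ, 0 ≤ t → v t = u t) ∧
        ∀ t : ℝ, 0 ≤ t →
          NLS.energy p (u t) ≤ C * NLS.energy p u₀ * Real.exp (-β * t) := by
  obtain ⟨m, rfl⟩ := hodd
  have hm : 1 ≤ m := by omega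
  obtain ⟨d⟩ := ha.nonempty_virialData
  obtain ⟨K, δ, β, C, hβ, hC, hL⟩ := d.exists_lyapunov hm
  refine ⟨2 * C, β, by positivity, hβ, fun u₀ => ?_⟩
  set x₀ := NLS.toSob u₀ with hx₀
  set E₀ := NLS.baseEnergy m x₀ with hE₀
  have hE₀0 : 0 ≤ E₀ := NLS.baseEnergy_nonneg m x₀
  have hF := NLS.lipOnBalls_field d.aS m
  have hdecay : ∀ f : ℝ → NLS.Sob, Continuous f → ∀ T, 0 ≤ T →
      (∀ t ∈ Set.Ioo 0 T, f t = NLS.field d.aS m (NLS.mild x₀ f t)) →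
      NLS.baseEnergy m (NLS.mild x₀ f T) ≤ 2 * C * E₀ * Real.exp (-β * T) := by
    intro f hf T hT hfT
    have h1 := d.lyapunov_decay (fun u => (hL u).1) x₀ hf hfT (Set.right_mem_Icc.2 hT)
    have h2 := (hL (NLS.mild x₀ f T)).2.1
    have h3 := mul_le_mul_of_nonneg_right (hL x₀).2.2 (Real.exp_nonneg (-β * T))
    linarith
  have hexp : ∀ T : ℝ, 0 ≤ T → Real.exp (-β * T) ≤ 1 := fun T hT =>
    Real.exp_le_one_iff.2 (by nlinarith)
  have hbound : ∀ x : NLS.Sob, NLS.baseEnergy m x ≤ 2 * C * E₀ → ‖x‖ ≤ √(4 * C * E₀) :=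
    fun x hx => Real.le_sqrt_of_sq_le ((NLS.norm_sq_le_baseEnergy m x).trans (by linarith))
  have hex : ∀ n : ℕ, ∃ f, NLS.IsMildSolution (NLS.field d.aS m) x₀ n f := fun n => by
    refine NLS.exists_isMildSolution hF (ρ := √(4 * C * E₀)) (hbound _ ?_)
      (fun f hf T hT hfT => hbound _ ((hdecay f hf T hT hfT).trans ?_)) n.cast_nonneg
    · linarith [(hL x₀).2.1, (hL x₀).2.2]
    · exact mul_le_of_le_one_right (by positivity) (hexp T hT)
  choose f hf using hex
  set y : ℝ → NLS.Sob := fun t => NLS.mild x₀ (f ⌈t⌉₊) t with hy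
  have hyn : ∀ n : ℕ, ∀ t ∈ Set.Icc (0 : ℝ) n, y t = NLS.mild x₀ (f n) t := fun n t ht =>
    (hf ⌈t⌉₊).eqOn hF ((hf n).mono (by exact_mod_cast Nat.ceil_le.2 ht.2))
      ⟨ht.1, Nat.le_ceil t⟩
  refine ⟨fun t => NLS.ofSob (y t),
    NLS.isStrongSolution_of_isMildSolution d.cont_aS m fun n => ⟨f n, hf n, hyn n⟩,
    fun v hv t ht => ?_, fun t ht => ?_⟩
  · obtain ⟨g, hg, hgv⟩ := hv.exists_isMildSolution d.cont_aS m (T := ⌈t⌉₊) (by positivity)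
    have ht' : t ∈ Set.Icc (0 : ℝ) ⌈t⌉₊ := ⟨ht, Nat.le_ceil t⟩
    rw [← NLS.ofSob_toSob (v t), ← hgv t ht', hg.eqOn hF (hf ⌈t⌉₊) ht']
  · rw [NLS.energy_eq, NLS.energy_eq, NLS.toSob_ofSob]
    have h := hdecay (f ⌈t⌉₊) (hf _).continuous t ht fun s hs =>
      (hf _).eq s ⟨hs.1.le, hs.2.le.trans (Nat.le_ceil t)⟩
    calc 2 * π * NLS.baseEnergy m (y t) ≤ 2 * π * (2 * C * E₀ * Real.exp (-β * t)) := by gcongr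
      _ = _ := by ring
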